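/- Setting. A matching on the node set $V=\{0,\dots,n-1\}$ has the matching matrix with entries $1/2$ at $(u,u),(v,v),(u,v),(v,u)$ for each matched pair $\{u,v\}$, with the identity row for each unmatched node, and $0$ elsewhere. In a balancing circuit with period $\mathbf M^{(1)},\dots,\mathbf M^{(d)}$ ($d\ge 1$) these matchings are applied periodically; one round is one execution of the whole period, and $\mathbf M=\mathbf M^{(1)}\cdots\mathbf M^{(d)}$ is the round matrix. Let $\lambda=\lambda(\mathbf M)$ be the second largest absolute value of an eigenvalue of $\mathbf M$ if $\mathbf M$ is symmetric, and the second largest eigenvalue of $\mathbf M\mathbf M^{T}$ otherwise (with multiplicity). Loads are integers: two matched nodes with loads $a,b$ get $\lceil (a+b)/2\rceil$ and $\lfloor (a+b)/2\rfloor$ tokens, an independent fair coin deciding which of them gets which. The discrepancy is $\operatorname{disc}(x)=\max_u x_u-\min_u x_u$. The initial loads are independent with a distribution $D$ on $\{0,1,2,\dots\}$ with mean $\mu$ and finite variance $\sigma^2$, exponentially concentrated with constants $A,\kappa$ ($\kappa>0$): $\Pr[|X-\mu|\ge\delta\sigma]\le A\,e^{-\kappa\delta}$ for $X\sim D$ and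 all $\delta>0$. "$\log$" is the natural logarithm. Theorem. For all $A$ and $\kappa>0$ there are $K,c>0$ and $n_0\in\mathbb N$, depending only on $A$ and $\kappa$, such that the following holds for every such $D$. 1. (Balancing circuits, in particular expanders, where $\lambda$ is bounded away from $1$; upper bound.) For all $n\ge1$, $d\ge1$, $t\ge 0$ and every period of $d$ matchings on $n$ nodes, with probability at least $1-K/n$ the load vector $x^{(t)}$ after $t$ rounds satisfies $$\operatorname{disc}(x^{(t)})\le K\left(\lambda^{t/4}\,\sigma\,(\log n)^{3/2}+\sqrt{\log n}\right).$$ 2. (Balancing circuits, in particular expanders; lower bound.) If $\sigma\ge2$, $n\ge n_0$ and $2\cdot 2^{dt}\le n$, then for every period of $d$ matchings on $n$ nodes, with probability at least $1/16$, $$\operatorname{disc}(x^{(t)})\ge c\cdot 2^{-dt/2}\,\sigma/\sqrt{\log\sigma}.$$ 3. (Hypercube, upper bound.) Let $n=2^k$, and let the circuit be dimension exchange, whose $i$-th matching pairs the nodes whose binary representations differ exactly in bit $i$ ($1\le i\le k$). For $1\le t<\log_2 n$, with probability at least $1-K/n$ the load vector $x$ after $t$ matchings satisfies $$\operatorname{disc}(x)\le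 K\left(2^{-t/2}\,\sigma\,(\log n)^{3/2}+\sqrt{\log n}\right).$$ 4. (Hypercube, lower bound.) If moreover $\sigma\ge 2$ and $n\ge n_0$, then for $1\le t<\log_2 n$, with probability at least $1/16$, $$\operatorname{disc}(x)\ge c\cdot 2^{-t/2}\,\sigma/\sqrt{\log\sigma}.$$ -/

import Mathlib

open MeasureTheory ProbabilityTheory

noncomputable section

namespace LoadBalancing

/-- A matching on the vertex set `{0, …, n - 1}`, given by its partner map: `partner u` is the node
matched with `u`, and `partner u = u` means that `u` is unmatched. -/
structure Matching (n : ℕ) where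
  partner : Fin n → Fin n
  partner_partner : ∀ u, partner (partner u) = u

/-- The matching matrix: `1/2` at `(u,u)` and at `(u,v)` for a matched pair `{u,v}`, and the row of
the identity matrix for an unmatched node. -/
def Matching.matrix {n : ℕ} (m : Matching n) : Matrix (Fin n) (Fin n) ℝ :=
  Matrix.of fun u v =>
    if m.partner u = u then (if v = u then 1 else 0)
    else if v = u ∨ v = m.partner u then 1 / 2 else 0

/-- The round matrix `M⁽¹⁾ M⁽²⁾ ⋯ M⁽ᵈ⁾` of a period of `d` matchings. -/
def roundMatrix {n d : ℕ} (m : Fin d → Matching n) : Matrix (Fin n) (Fin n) ℝ :=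
  (List.ofFn fun s => (m s).matrix).prod

/-- The second largest absolute value of an eigenvalue of a real symmetric matrix, eigenvalues
being counted with multiplicity (and `0` for a `1 × 1` matrix). -/
def secondAbsEigenvalue {n : ℕ} {A : Matrix (Fin n) (Fin n) ℝ} (hA : A.IsHermitian) : ℝ :=
  (Multiset.sort (Finset.univ.val.map fun i => |hA.eigenvalues i|) (· ≥ ·)).getD 1 0

open Classical in
/-- `λ(M)`: the second largest eigenvalue in absolute value of `M` if `M` is symmetric, and the
second largest eigenvalue of `M Mᵀ` otherwise (`M Mᵀ` is positive semidefinite, so that the absolute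
values make no difference there). -/
def lam {n : ℕ} (M : Matrix (Fin n) (Fin n) ℝ) : ℝ :=
  if h : M.IsHermitian then secondAbsEigenvalue h
  else secondAbsEigenvalue (Matrix.isHermitian_mul_conjTranspose_self M)

/-- One balancing step on indivisible tokens. A matched pair `{u,v}` shares its tokens as evenly as
possible; the coin of the smaller endpoint decides which endpoint gets the rounded-up half (`true`:
the smaller one). Here `(x u + x v) / 2` is the integer floor. -/
def Matching.balance {n : ℕ} (m : Matching n) (coin : Fin n → Bool) (x : Fin n → ℤ) :
    Fin n → ℤ := fun u =>
  let v := m.partner u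
  let total := x u + x v
  if v = u then x u
  else if (coin (min u v) = true ↔ u < v) then total - total / 2
  else total / 2

/-- The random orientation rule: independent fair coins for all pairs of the matching. -/
def Matching.randomStep {n : ℕ} (m : Matching n) (x : Fin n → ℤ) : PMF (Fin n → ℤ) :=
  (PMF.uniformOfFintype (Fin n → Bool)).map fun coin => m.balance coin x

/-- The law of the load vector after the first `s` matchings of the sequence `m`, started from the
load vector `x₀`; fresh coins are used in every step. -/
def run {n : ℕ} (m : ℕ → Matching n) (x₀ : Fin n → ℤ) : ℕ → PMF (Fin n → ℤ)
  | 0 => PMF.pure x₀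
  | s + 1 => (run m x₀ s).bind (m s).randomStep

/-- The law of the load vector after `s` matchings if the initial numbers of tokens on the nodes are
independent with distribution `D`. -/
def loadLaw {n : ℕ} (D : Measure ℕ) (m : ℕ → Matching n) (s : ℕ) : Measure (Fin n → ℤ) :=
  (Measure.pi fun _ : Fin n => D).bind fun x₀ => (run m (fun u => (x₀ u : ℤ)) s).toMeasure

/-- The balancing circuit: the `d` matchings of the period are applied periodically. -/
def circuit {n d : ℕ} (hd : 0 < d) (m : Fin d → Matching n) : ℕ → Matching n :=
  fun s => m ⟨s % d, Nat.mod_lt s hd⟩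

/-- Dimension exchange on the hypercube with `2 ^ k` nodes: the `i`-th matching of the period pairs
the nodes whose binary representations differ exactly in bit `i`. -/
def hypercube (k : ℕ) (i : Fin k) : Matching (2 ^ k) where
  partner u := ⟨u.val ^^^ 2 ^ i.val,
    Nat.xor_lt_two_pow u.isLt (Nat.pow_lt_pow_right (by norm_num) i.isLt)⟩
  partner_partner u := by
    apply Fin.ext
    simp

/-- The discrepancy `max x - min x` of a load vector. -/
def disc {n : ℕ} (x : Fin n → ℤ) : ℤ := (⨆ u, x u) - ⨅ u, x u

/-- The expectation of `D`. -/
def mean (D : Measure ℕ) : ℝ := ∫ k : ℕ, (k : ℝ) ∂D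

/-- The standard deviation of `D`. -/
def sd (D : Measure ℕ) : ℝ := √(variance (fun k : ℕ => (k : ℝ)) D)

/-- `D` has finite variance `σ²` and, with `μ` its expectation,
`P(|X - μ| ≥ δ σ) ≤ A exp(-κ δ)` for `X ∼ D` and all `δ > 0`. -/
structure ExpConcentrated (D : Measure ℕ) (A κ : ℝ) : Prop where
  memLp : MemLp (fun k : ℕ => (k : ℝ)) 2 D
  tail : ∀ δ : ℝ, 0 < δ →
    D.real {k : ℕ | δ * sd D ≤ |(k : ℝ) - mean D|} ≤ A * Real.exp (-κ * δ)

end LoadBalancing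

end

open scoped ENNReal

namespace LoadBalancing

/-! Without rounding the loads evolve linearly; the real process is this linear process plus
rounding errors. Test the loads against a vector `a` and read the process backwards: one matching
replaces `a` by `m.avg a` and adds, for each pair with odd total, a fair sign times half the
difference of `a` across the pair. By `cosh x ≤ exp (x ^ 2 / 2)` this costs, in the exponent of the
exponential moment, at most a quarter of the drop of `∑ u, a u ^ 2` (`Matching.sum_sq_avg`). The
costs telescope, so the rounding error is subgaussian at scale `‖a‖₂`, however long the run
(`expect_run_le`).

Upper bounds (`exists_disc_upper`): up to this error, a difference of two loads is a combination of
the independent initial loads. Exponential concentration controls its moment generating function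
near zero, and Chernoff's bound with a union over pairs of nodes concludes. The only input about the
network is the `ℓ²` norm of the difference of two rows: it contracts by the second eigenvalue for
circuits, and is explicit for dimension exchange.

Lower bounds (`exists_disc_lower`): take two independent copies of the initial loads and exchange
coordinates at random. A matching at most halves the squared norm of a nonnegative vector, so unit
mass at one node keeps squared norm at least `2⁻ˢ` after `s` matchings. Hence at some node the two
linear processes differ by a random sign sum of size about `2 ^ (-s / 2) * sd D`, and with constant
probability one copy is far from its average; the subgaussian rounding error rarely hides this. When
that scale is bounded, the target is below `1` and it suffices that the loads are not all equal.
This holds if the total is not divisible by `n`, again by exchanging coordinates. -/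

variable {n : ℕ}

/-! ### Averaging along a matching -/

/-- The continuous balancing step. -/
noncomputable def Matching.avg (m : Matching n) (a : Fin n → ℝ) : Fin n → ℝ :=
  fun u => (a u + a (m.partner u)) / 2

/-- The partner map as a permutation. -/
def Matching.perm (m : Matching n) : Equiv.Perm (Fin n) :=
  Function.Involutive.toPerm m.partner m.partner_partner

lemma Matching.sum_partner {R : Type*} [AddCommMonoid R] (m : Matching n) (f : Fin n → R) :
    ∑ u, f (m.partner u) = ∑ u, f u :=
  Equiv.sum_comp m.perm f

lemma Matching.matrix_mulVec (m : Matching n) (a : Fin n → ℝ) :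
    m.matrix.mulVec a = m.avg a := by
  funext u
  simp only [Matrix.mulVec, dotProduct, Matching.matrix, Matching.avg, Matrix.of_apply]
  split_ifs with h
  · simp [h]
  · have : ∀ v, (if v = u ∨ v = m.partner u then (1 / 2 : ℝ) else 0) * a v
        = (if v = u then a v / 2 else 0) + (if v = m.partner u then a v / 2 else 0) := by
      intro v
      by_cases h1 : v = u
      · have h2 : v ≠ m.partner u := by rw [h1]; exact fun e => h e.symm
        simp only [h1, true_or, if_true, if_neg (fun e => h e.symm : ¬ u = m.partner u)]
        ring
      · by_cases h2 : v = m.partner u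
        · simp only [h2, or_true, if_true, if_neg h]; ring
        · simp [h1, h2]
    simp only [this, Finset.sum_add_distrib, Finset.sum_ite_eq', Finset.mem_univ, if_true]
    ring

lemma Matching.sum_avg (m : Matching n) (a : Fin n → ℝ) : ∑ u, m.avg a u = ∑ u, a u := by
  simp only [Matching.avg, ← Finset.sum_div, Finset.sum_add_distrib, m.sum_partner a]
  ring

lemma Matching.sum_avg_mul (m : Matching n) (a b : Fin n → ℝ) :
    ∑ u, m.avg a u * b u = ∑ u, a u * m.avg b u := by
  have h := m.sum_partner (fun u => a u * b (m.partner u))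
  simp only [m.partner_partner] at h
  have h1 : ∀ u, m.avg a u * b u = a u * b u / 2 + a (m.partner u) * b u / 2 := fun u => by
    simp only [Matching.avg]; ring
  have h2 : ∀ u, a u * m.avg b u = a u * b u / 2 + a u * b (m.partner u) / 2 := fun u => by
    simp only [Matching.avg]; ring
  simp only [h1, h2, Finset.sum_add_distrib, ← Finset.sum_div, h]

/-- A sum over all nodes, arranged along the pairs of the matching. -/
lemma Matching.sum_pairs (m : Matching n) (f : Fin n → ℝ) :
    ∑ u, f u = ∑ u, ((if u < m.partner u then f u + f (m.partner u) else 0)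
      + (if m.partner u = u then f u else 0)) := by
  have h := m.sum_partner (fun u => if m.partner u < u then f u else 0)
  simp only [m.partner_partner] at h
  have h1 : ∀ u, f u = (if u < m.partner u then f u else 0)
      + (if m.partner u < u then f u else 0) + (if m.partner u = u then f u else 0) := by
    intro u
    rcases lt_trichotomy u (m.partner u) with h | h | h
    · simp [h, h.not_gt, h.ne']
    · simp [← h]
    · simp [h, h.not_gt, h.ne]
  have h2 : ∀ u, (if u < m.partner u then f u + f (m.partner u) else 0)
      = (if u < m.partner u then f u else 0) + (if u < m.partner u then f (m.partner u) else 0) := by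
    intro u; split_ifs <;> simp
  rw [Finset.sum_congr rfl fun u _ => h1 u]
  simp only [Finset.sum_add_distrib, h2, h]

/-- Each pair contributes `a² + b² - 2 ((a + b) / 2)² = (a - b)² / 2`. This decrease pays for the
rounding noise of the step. -/
lemma Matching.sum_sq_avg (m : Matching n) (a : Fin n → ℝ) :
    ∑ u, a u ^ 2 - ∑ u, m.avg a u ^ 2
      = ∑ u, if u < m.partner u then (a u - a (m.partner u)) ^ 2 / 2 else 0 := by
  rw [m.sum_pairs (fun u => a u ^ 2), m.sum_pairs (fun u => m.avg a u ^ 2),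
    ← Finset.sum_sub_distrib]
  refine Finset.sum_congr rfl fun u _ => ?_
  simp only [Matching.avg, m.partner_partner]
  split_ifs with h1 h2 h2
  · exact absurd h2 h1.ne'
  · ring
  · rw [h2]; ring
  · ring

lemma Matching.sum_sq_avg_le (m : Matching n) (a : Fin n → ℝ) :
    ∑ u, m.avg a u ^ 2 ≤ ∑ u, a u ^ 2 := by
  have := m.sum_sq_avg a
  have h : 0 ≤ ∑ u, if u < m.partner u then (a u - a (m.partner u)) ^ 2 / 2 else 0 :=
    Finset.sum_nonneg fun u _ => by split_ifs <;> positivity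
  linarith

/-- For nonnegative entries the cross term in `((a + b) / 2)²` may be dropped. -/
lemma Matching.half_sum_sq_le (m : Matching n) (a : Fin n → ℝ) (ha : ∀ u, 0 ≤ a u) :
    (∑ u, a u ^ 2) / 2 ≤ ∑ u, m.avg a u ^ 2 := by
  have h := m.sum_partner (fun u => a u ^ 2)
  have h1 : ∑ u, (a u ^ 2 / 4 + a (m.partner u) ^ 2 / 4) ≤ ∑ u, m.avg a u ^ 2 := by
    refine Finset.sum_le_sum fun u _ => ?_
    simp only [Matching.avg]
    nlinarith [mul_nonneg (ha u) (ha (m.partner u))]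
  rw [Finset.sum_add_distrib, ← Finset.sum_div, ← Finset.sum_div, h] at h1
  linarith

/-- The composition of the first `s` averaging steps, the last one being applied first. -/
noncomputable def pull (m : ℕ → Matching n) : ℕ → (Fin n → ℝ) → Fin n → ℝ
  | 0, a => a
  | s + 1, a => pull m s ((m s).avg a)

/-- The composition of the first `s` averaging steps, the first one being applied first. -/
noncomputable def push (m : ℕ → Matching n) : ℕ → (Fin n → ℝ) → Fin n → ℝ
  | 0, a => a
  | s + 1, a => (m s).avg (push m s a)

/-- Each averaging step is self-adjoint, so `pull`, which acts on test vectors, is the adjoint of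
`push`, which acts on loads. -/
lemma sum_pull_mul (m : ℕ → Matching n) (s : ℕ) (a b : Fin n → ℝ) :
    ∑ u, pull m s a u * b u = ∑ u, a u * push m s b u := by
  induction s generalizing a with
  | zero => rfl
  | succ s ih => rw [pull, push, ih, Matching.sum_avg_mul]

lemma sum_pull (m : ℕ → Matching n) (s : ℕ) (a : Fin n → ℝ) :
    ∑ u, pull m s a u = ∑ u, a u := by
  induction s generalizing a with
  | zero => rfl
  | succ s ih => rw [pull, ih, Matching.sum_avg]

lemma sum_push (m : ℕ → Matching n) (s : ℕ) (a : Fin n → ℝ) :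
    ∑ u, push m s a u = ∑ u, a u := by
  induction s with
  | zero => rfl
  | succ s ih => rw [push, Matching.sum_avg, ih]

lemma pull_nonneg (m : ℕ → Matching n) (s : ℕ) (a : Fin n → ℝ) (ha : ∀ u, 0 ≤ a u) (u : Fin n) :
    0 ≤ pull m s a u := by
  induction s generalizing a with
  | zero => exact ha u
  | succ s ih =>
    exact ih _ fun u => div_nonneg (add_nonneg (ha _) (ha _)) zero_le_two

lemma push_nonneg (m : ℕ → Matching n) (s : ℕ) (a : Fin n → ℝ) (ha : ∀ u, 0 ≤ a u) (u : Fin n) :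
    0 ≤ push m s a u := by
  induction s generalizing u with
  | zero => exact ha u
  | succ s ih => exact div_nonneg (add_nonneg (ih _) (ih _)) zero_le_two

lemma push_add (m : ℕ → Matching n) (s : ℕ) (a b : Fin n → ℝ) :
    push m s (a + b) = push m s a + push m s b := by
  induction s with
  | zero => rfl
  | succ s ih =>
    funext u
    simp only [push, ih, Matching.avg, Pi.add_apply]; ring

lemma push_smul (m : ℕ → Matching n) (s : ℕ) (c : ℝ) (a : Fin n → ℝ) :
    push m s (c • a) = c • push m s a := by
  induction s with
  | zero => rfl
  | succ s ih =>
    funext u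
    simp only [push, ih, Matching.avg, Pi.smul_apply, smul_eq_mul]; ring

/-- `push` as a linear map. -/
noncomputable def pushLin (m : ℕ → Matching n) (s : ℕ) : (Fin n → ℝ) →ₗ[ℝ] Fin n → ℝ where
  toFun := push m s
  map_add' := push_add m s
  map_smul' := push_smul m s

lemma pull_add (m : ℕ → Matching n) (s : ℕ) (a b : Fin n → ℝ) :
    pull m s (a + b) = pull m s a + pull m s b := by
  induction s generalizing a b with
  | zero => rfl
  | succ s ih =>
    simp only [pull, ← ih]
    congr 1; funext u; simp only [Matching.avg, Pi.add_apply]; ring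

lemma pull_smul (m : ℕ → Matching n) (s : ℕ) (c : ℝ) (a : Fin n → ℝ) :
    pull m s (c • a) = c • pull m s a := by
  induction s generalizing a with
  | zero => rfl
  | succ s ih =>
    simp only [pull, ← ih]
    congr 1; funext u; simp only [Matching.avg, Pi.smul_apply, smul_eq_mul]; ring

lemma pull_sub (m : ℕ → Matching n) (s : ℕ) (a b : Fin n → ℝ) :
    pull m s (a - b) = pull m s a - pull m s b := by
  have h : a - b = a + (-1 : ℝ) • b := by rw [neg_one_smul, sub_eq_add_neg]
  rw [h, pull_add, pull_smul, neg_one_smul, sub_eq_add_neg]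

lemma two_pow_neg_le_sum_sq_push (m : ℕ → Matching n) (s : ℕ) (w : Fin n) :
    ((2 : ℝ) ^ s)⁻¹ ≤ ∑ u, push m s (Pi.single w 1) u ^ 2 := by
  have h0 : ∀ u, (0 : ℝ) ≤ (Pi.single w 1 : Fin n → ℝ) u := fun u => by
    by_cases h : u = w
    · subst h; simp
    · simp [h]
  induction s with
  | zero =>
    simp only [push, pow_zero, inv_one]
    rw [Finset.sum_eq_single w] <;> simp +contextual
  | succ s ih =>
    have := (m s).half_sum_sq_le _ (push_nonneg m s _ h0)
    simp only [push]
    rw [pow_succ, mul_inv]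
    linarith

/-! ### The exponential moments of the load vector -/

/-- The expectation of a nonnegative function. -/
noncomputable def expect {α : Type*} (p : PMF α) (f : α → ℝ≥0∞) : ℝ≥0∞ := ∑' x, p x * f x

lemma expect_bind {α β : Type*} (p : PMF α) (k : α → PMF β) (f : β → ℝ≥0∞) :
    expect (p.bind k) f = expect p fun x => expect (k x) f := by
  simp only [expect, PMF.bind_apply, ← ENNReal.tsum_mul_right, ← ENNReal.tsum_mul_left]
  rw [ENNReal.tsum_comm]
  simp only [mul_assoc]

lemma expect_pure {α : Type*} (x : α) (f : α → ℝ≥0∞) : expect (PMF.pure x) f = f x := by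
  rw [expect, tsum_eq_single x]
  · simp
  · intro y hy; simp [hy]

lemma expect_map {α β : Type*} (p : PMF α) (g : α → β) (f : β → ℝ≥0∞) :
    expect (p.map g) f = expect p (f ∘ g) := by
  rw [PMF.map, expect_bind]
  simp only [Function.comp_def, expect_pure]

lemma expect_mono {α : Type*} (p : PMF α) {f g : α → ℝ≥0∞} (h : ∀ x, f x ≤ g x) :
    expect p f ≤ expect p g :=
  ENNReal.tsum_le_tsum fun x => mul_le_mul_right (h x) _

lemma expect_mul_const {α : Type*} (p : PMF α) (f : α → ℝ≥0∞) (c : ℝ≥0∞) :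
    expect p (fun x => f x * c) = expect p f * c := by
  simp only [expect, ← mul_assoc, ENNReal.tsum_mul_right]

lemma toMeasure_le_expect {α : Type*} [MeasurableSpace α] [DiscreteMeasurableSpace α] (p : PMF α)
    (S : Set α) (f : α → ℝ≥0∞) (h : ∀ x ∈ S, 1 ≤ f x) : p.toMeasure S ≤ expect p f := by
  rw [PMF.toMeasure_apply _ (MeasurableSet.of_discrete)]
  refine ENNReal.tsum_le_tsum fun x => ?_
  by_cases hx : x ∈ S
  · simp only [Set.indicator_of_mem hx]
    calc p x = p x * 1 := (mul_one _).symm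
      _ ≤ _ := mul_le_mul_right (h x hx) _
  · simp [hx]

/-- The standard inner product of a real vector with a load vector. -/
noncomputable def pairing (a : Fin n → ℝ) (x : Fin n → ℤ) : ℝ := ∑ u, a u * (x u : ℝ)

/-- Uniform coins are independent. -/
lemma expect_uniform_prod (g : Fin n → Bool → ℝ) (hg : ∀ i b, 0 ≤ g i b) :
    expect (PMF.uniformOfFintype (Fin n → Bool)) (fun c => ENNReal.ofReal (∏ i, g i (c i)))
      = ENNReal.ofReal (∏ i, (g i true + g i false) / 2) := by
  have h1 : ∏ i, (g i true + g i false) = ∑ c : Fin n → Bool, ∏ i, g i (c i) := by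
    have := Finset.prod_univ_sum (fun _ : Fin n => (Finset.univ : Finset Bool)) g
    rw [Fintype.piFinset_univ] at this
    simpa using this
  rw [expect, tsum_fintype]
  simp only [PMF.uniformOfFintype_apply]
  rw [← Finset.mul_sum, ← ENNReal.ofReal_sum_of_nonneg
    (fun c _ => Finset.prod_nonneg fun i _ => hg i _), ← h1, Finset.prod_div_distrib]
  rw [div_eq_inv_mul, ENNReal.ofReal_mul (by positivity)]
  congr 1
  simp only [Fintype.card_pi, Fintype.card_bool, Finset.prod_const, Finset.card_univ,
    Fintype.card_fin]
  rw [ENNReal.ofReal_inv_of_pos (by positivity)]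
  simp [ENNReal.ofReal_pow]

/-- The contribution of the coin of node `i` to the rounding error tested against `a`. -/
noncomputable def Matching.noise (m : Matching n) (a : Fin n → ℝ) (x : Fin n → ℤ) (i : Fin n) : ℝ :=
  if i < m.partner i ∧ (x i + x (m.partner i)) % 2 = 1 then (a i - a (m.partner i)) / 2 else 0

/-- An odd pair is off its exact average by `1/2` up at one endpoint and `1/2` down at the other,
the coin choosing which. The noise is stored at the smaller endpoint, which owns the coin, so the
summands are independent. -/
lemma Matching.pairing_balance (m : Matching n) (c : Fin n → Bool) (a : Fin n → ℝ)
    (x : Fin n → ℤ) :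
    pairing a (m.balance c x) = pairing (m.avg a) x
      + ∑ i, (if c i = true then m.noise a x i else - m.noise a x i) := by
  have h0 : pairing (m.avg a) x = ∑ u, a u * m.avg (fun v => (x v : ℝ)) u :=
    m.sum_avg_mul a _
  rw [h0, pairing, m.sum_pairs, m.sum_pairs (fun u => a u * m.avg (fun v => (x v : ℝ)) u),
    ← Finset.sum_add_distrib]
  refine Finset.sum_congr rfl fun u _ => ?_
  simp only [Matching.balance, Matching.avg, m.partner_partner, Matching.noise]
  set v := m.partner u with hv
  rcases lt_trichotomy u v with h | h | h
  · have h1 : ¬ v = u := h.ne'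
    have h2 : ¬ u = v := h.ne
    have h3 : ¬ v < u := h.not_gt
    simp only [if_neg h1, if_neg h2, min_eq_left h.le, min_eq_right h.le, h, h3, iff_true,
      iff_false, true_and, add_zero, add_comm (x v) (x u)]
    rcases Int.emod_two_eq_zero_or_one (x u + x v) with hp | hp
    · obtain ⟨k, hk⟩ : ∃ k, x u + x v = 2 * k := ⟨(x u + x v) / 2, by omega⟩
      have e1 : (x u + x v) / 2 = k := by omega
      have hk' : (x u : ℝ) + x v = 2 * k := by exact_mod_cast hk
      simp only [e1, hp]
      rw [show (x u : ℝ) = 2 * k - x v by linarith, show x u = 2 * k - x v by omega]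
      cases c u <;> simp <;> ring_nf <;> simp
    · obtain ⟨k, hk⟩ : ∃ k, x u + x v = 2 * k + 1 := ⟨(x u + x v) / 2, by omega⟩
      have e1 : (x u + x v) / 2 = k := by omega
      have hk' : (x u : ℝ) + x v = 2 * k + 1 := by exact_mod_cast hk
      simp only [e1, hp]
      rw [show (x u : ℝ) = 2 * k + 1 - x v by linarith, show x u = 2 * k + 1 - x v by omega]
      cases c u <;> simp <;> ring
  · rw [← h]; simp
  · have h1 : ¬ v = u := h.ne
    simp [h.not_gt, h1]

/-- One balancing step: the exponential moments are governed by the decrease of the `ℓ²` norm. -/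
lemma Matching.expect_randomStep_le (m : Matching n) (a : Fin n → ℝ) (x : Fin n → ℤ) :
    expect (m.randomStep x) (fun y => ENNReal.ofReal (Real.exp (pairing a y)))
      ≤ ENNReal.ofReal (Real.exp (pairing (m.avg a) x))
        * ENNReal.ofReal (Real.exp ((∑ u, a u ^ 2 - ∑ u, m.avg a u ^ 2) / 4)) := by
  rw [Matching.randomStep, expect_map]
  have h1 : ((fun y => ENNReal.ofReal (Real.exp (pairing a y))) ∘ fun c => m.balance c x)
      = fun c => ENNReal.ofReal (∏ i, Real.exp (if c i = true then m.noise a x i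
          else - m.noise a x i)) * ENNReal.ofReal (Real.exp (pairing (m.avg a) x)) := by
    funext c
    simp only [Function.comp]
    rw [m.pairing_balance, Real.exp_add, Real.exp_sum, mul_comm,
      ENNReal.ofReal_mul (Finset.prod_nonneg fun i _ => (Real.exp_pos _).le)]
  rw [h1, expect_mul_const, mul_comm]
  gcongr
  rw [expect_uniform_prod (fun i b => Real.exp (if b = true then m.noise a x i
    else - m.noise a x i)) (fun i b => (Real.exp_pos _).le)]
  apply ENNReal.ofReal_le_ofReal
  calc ∏ i, (Real.exp (if true = true then m.noise a x i else - m.noise a x i)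
        + Real.exp (if false = true then m.noise a x i else - m.noise a x i)) / 2
      ≤ ∏ i, Real.exp (m.noise a x i ^ 2 / 2) := by
        refine Finset.prod_le_prod (fun i _ => div_nonneg (add_nonneg (Real.exp_pos _).le
          (Real.exp_pos _).le) zero_le_two) fun i _ => ?_
        have := Real.cosh_le_exp_half_sq (m.noise a x i)
        rw [Real.cosh_eq] at this
        simpa using this
    _ = Real.exp (∑ i, m.noise a x i ^ 2 / 2) := (Real.exp_sum _ _).symm
    _ ≤ _ := by
        apply Real.exp_le_exp.2
        -- For an odd pair, half the squared noise is `(a i - a j)² / 8`, exactly a quarter of the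
        -- pair's decrease `(a i - a j)² / 2`.
        rw [m.sum_sq_avg, Finset.sum_div]
        refine Finset.sum_le_sum fun i _ => ?_
        simp only [Matching.noise]
        by_cases h : i < m.partner i
        · by_cases h' : (x i + x (m.partner i)) % 2 = 1
          · simp only [h, h', and_self, if_true]; apply le_of_eq; ring
          · rw [if_neg (fun e => h' e.2), if_pos h, zero_pow two_ne_zero, zero_div]; positivity
        · simp [h]

/-- The exponential moments of the load vector started from a fixed vector. -/
theorem expect_run_le (m : ℕ → Matching n) (x₀ : Fin n → ℤ) (s : ℕ) (a : Fin n → ℝ) :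
    expect (run m x₀ s) (fun y => ENNReal.ofReal (Real.exp (pairing a y)))
      ≤ ENNReal.ofReal (Real.exp (pairing (pull m s a) x₀))
        * ENNReal.ofReal (Real.exp ((∑ u, a u ^ 2) / 4)) := by
  induction s generalizing a with
  | zero =>
    rw [run, expect_pure, pull, ← ENNReal.ofReal_mul (Real.exp_pos _).le, ← Real.exp_add]
    apply ENNReal.ofReal_le_ofReal
    apply Real.exp_le_exp.2
    have : 0 ≤ ∑ u, a u ^ 2 := Finset.sum_nonneg fun u _ => sq_nonneg _
    linarith
  | succ s ih =>
    rw [run, expect_bind]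
    calc _ ≤ expect (run m x₀ s) (fun x => ENNReal.ofReal (Real.exp (pairing ((m s).avg a) x))
            * ENNReal.ofReal (Real.exp ((∑ u, a u ^ 2 - ∑ u, (m s).avg a u ^ 2) / 4))) :=
          expect_mono _ fun x => (m s).expect_randomStep_le a x
      _ ≤ ENNReal.ofReal (Real.exp (pairing (pull m s ((m s).avg a)) x₀))
            * ENNReal.ofReal (Real.exp ((∑ u, (m s).avg a u ^ 2) / 4))
            * ENNReal.ofReal (Real.exp ((∑ u, a u ^ 2 - ∑ u, (m s).avg a u ^ 2) / 4)) := by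
          rw [expect_mul_const]
          gcongr
          exact ih _
      _ = _ := by
          rw [mul_assoc, ← ENNReal.ofReal_mul (Real.exp_pos _).le, ← Real.exp_add, pull]
          congr 4; ring

lemma Matching.sum_balance (m : Matching n) (c : Fin n → Bool) (x : Fin n → ℤ) :
    ∑ u, m.balance c x u = ∑ u, x u := by
  have h := m.pairing_balance c (fun _ => 1) x
  have h1 : m.avg (fun _ => 1) = fun _ => 1 := by funext u; simp [Matching.avg]
  simp only [h1, pairing, Matching.noise, one_mul, sub_self, zero_div, ite_self, neg_zero,
    Finset.sum_const_zero, add_zero] at h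
  exact_mod_cast h

/-- The number of tokens does not change. -/
lemma sum_eq_of_mem_support_run (m : ℕ → Matching n) (x₀ : Fin n → ℤ) (s : ℕ) (x : Fin n → ℤ)
    (hx : x ∈ (run m x₀ s).support) : ∑ u, x u = ∑ u, x₀ u := by
  induction s generalizing x with
  | zero => rw [run, PMF.mem_support_pure_iff] at hx; rw [hx]
  | succ s ih =>
    rw [run, PMF.mem_support_bind_iff] at hx
    obtain ⟨y, hy, hxy⟩ := hx
    rw [Matching.randomStep, PMF.mem_support_map_iff] at hxy
    obtain ⟨c, -, rfl⟩ := hxy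
    rw [Matching.sum_balance, ih y hy]

lemma measurable_run (m : ℕ → Matching n) (s : ℕ) :
    Measurable fun x₀ : Fin n → ℕ => (run m (fun u => (x₀ u : ℤ)) s).toMeasure :=
  Measurable.of_discrete

lemma loadLaw_apply (D : Measure ℕ) (m : ℕ → Matching n) (s : ℕ) (S : Set (Fin n → ℤ)) :
    loadLaw D m s S = ∫⁻ x₀, (run m (fun u => (x₀ u : ℤ)) s).toMeasure S
      ∂(Measure.pi fun _ : Fin n => D) := by
  rw [loadLaw, Measure.bind_apply MeasurableSet.of_discrete (measurable_run m s).aemeasurable]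

instance (D : Measure ℕ) [IsProbabilityMeasure D] (m : ℕ → Matching n) (s : ℕ) :
    IsProbabilityMeasure (loadLaw D m s) := by
  constructor
  rw [loadLaw_apply]
  simp

/-! ### Exponentially concentrated distributions -/

section Distribution

variable {D : Measure ℕ} [IsProbabilityMeasure D] {A κ : ℝ}

/-- If the standard deviation were zero, the tail event would be everything for each `δ`, while its
bound tends to zero. -/
lemma ExpConcentrated.sd_pos (hD : ExpConcentrated D A κ) (hκ : 0 < κ) : 0 < sd D := by
  by_contra h
  have h0 : sd D = 0 := le_antisymm (not_lt.1 h) (Real.sqrt_nonneg _)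
  have h1 : ∀ δ : ℝ, 0 < δ → 1 ≤ A * Real.exp (-κ * δ) := by
    intro δ hδ
    have := hD.tail δ hδ
    have hu : {k : ℕ | δ * sd D ≤ |(k : ℝ) - mean D|} = Set.univ := by
      ext k; simp [h0]
    rwa [hu, probReal_univ] at this
  have h2 : Filter.Tendsto (fun δ : ℝ => A * Real.exp (-κ * δ)) Filter.atTop (nhds (A * 0)) := by
    refine Filter.Tendsto.const_mul _ (Real.tendsto_exp_atBot.comp ?_)
    exact Filter.tendsto_id.const_mul_atTop_of_neg (neg_neg_of_pos hκ)
  have h3 := ge_of_tendsto h2 ((Filter.eventually_gt_atTop 0).mono h1)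
  norm_num at h3

/-- The standardized load. -/
noncomputable def std (D : Measure ℕ) (k : ℕ) : ℝ := ((k : ℝ) - mean D) / sd D

/-- A bound for the exponential moment of order `κ / 2`. -/
noncomputable def expMomentBound (A κ : ℝ) : ℝ :=
  Real.exp (κ / 2) * (1 + |A|) * (1 - Real.exp (-(κ / 2)))⁻¹

lemma expMomentBound_pos (hκ : 0 < κ) : 0 < expMomentBound A κ := by
  have : Real.exp (-(κ / 2)) < 1 := by
    rw [← Real.exp_zero]; exact Real.exp_lt_exp.2 (by linarith)
  have h2 : 0 < 1 - Real.exp (-(κ / 2)) := by linarith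
  unfold expMomentBound
  positivity

/-- The constant `1 + |A|` also covers `j = 0`, where the tail hypothesis says nothing. -/
lemma ExpConcentrated.tail_std (hD : ExpConcentrated D A κ) (hκ : 0 < κ) (j : ℕ) :
    D {k | (j : ℝ) ≤ |std D k|} ≤ ENNReal.ofReal ((1 + |A|) * Real.exp (-κ * j)) := by
  rw [← ofReal_measureReal]
  apply ENNReal.ofReal_le_ofReal
  have hA := le_abs_self A
  rcases Nat.eq_zero_or_pos j with rfl | hj
  · simp only [Nat.cast_zero, mul_zero, Real.exp_zero, mul_one]
    have : D.real {k | (0 : ℝ) ≤ |std D k|} ≤ 1 := measureReal_le_one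
    linarith [abs_nonneg A]
  · have hs := hD.sd_pos hκ
    have h1 := hD.tail j (by exact_mod_cast hj)
    have h2 : {k | (j : ℝ) ≤ |std D k|} = {k : ℕ | j * sd D ≤ |(k : ℝ) - mean D|} := by
      ext k
      simp only [Set.mem_ofPred_eq, std, abs_div, abs_of_pos hs, le_div_iff₀ hs]
    rw [h2]
    refine h1.trans ?_
    gcongr
    linarith

/-- The exponential at `|std D k|` is at most the term of the series with `j = ⌊|std D k|⌋₊`. Tails
of rate `κ` against growth of rate `κ / 2` leave a geometric series of ratio `exp (-κ / 2)`. -/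
lemma ExpConcentrated.lintegral_exp_le (hD : ExpConcentrated D A κ) (hκ : 0 < κ) :
    ∫⁻ k, ENNReal.ofReal (Real.exp (κ / 2 * |std D k|)) ∂D
      ≤ ENNReal.ofReal (expMomentBound A κ) := by
  have h1 : ∀ k, ENNReal.ofReal (Real.exp (κ / 2 * |std D k|))
      ≤ ∑' j : ℕ, ENNReal.ofReal (Real.exp (κ / 2 * (j + 1)))
        * Set.indicator {k | (j : ℝ) ≤ |std D k|} (fun _ => 1) k := by
    intro k
    refine le_trans ?_ (ENNReal.le_tsum ⌊|std D k|⌋₊)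
    rw [Set.indicator_of_mem (show k ∈ {k' | (⌊|std D k|⌋₊ : ℝ) ≤ |std D k'|} from
      Nat.floor_le (abs_nonneg (std D k))), mul_one]
    apply ENNReal.ofReal_le_ofReal
    apply Real.exp_le_exp.2
    gcongr
    exact (Nat.lt_floor_add_one _).le
  have hr : Real.exp (-(κ / 2)) < 1 := by
    rw [← Real.exp_zero]; exact Real.exp_lt_exp.2 (by linarith)
  calc _ ≤ ∫⁻ k, ∑' j : ℕ, ENNReal.ofReal (Real.exp (κ / 2 * (j + 1)))
        * Set.indicator {k | (j : ℝ) ≤ |std D k|} (fun _ => 1) k ∂D := lintegral_mono h1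
    _ = ∑' j : ℕ, ENNReal.ofReal (Real.exp (κ / 2 * (j + 1))) * D {k | (j : ℝ) ≤ |std D k|} := by
        rw [lintegral_tsum fun j => Measurable.of_discrete.aemeasurable]
        congr 1; funext j
        rw [lintegral_const_mul _ Measurable.of_discrete,
          lintegral_indicator_const MeasurableSet.of_discrete, one_mul]
    _ ≤ ∑' j : ℕ, ENNReal.ofReal (Real.exp (κ / 2) * (1 + |A|) * Real.exp (-(κ / 2)) ^ j) := by
        refine ENNReal.tsum_le_tsum fun j => ?_
        refine (mul_le_mul_right (hD.tail_std hκ j) _).trans (le_of_eq ?_)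
        rw [← ENNReal.ofReal_mul (Real.exp_pos _).le]
        congr 1
        rw [← Real.exp_nat_mul, show κ / 2 * ((j : ℝ) + 1) = κ / 2 + κ / 2 * j by ring,
          show (j : ℝ) * -(κ / 2) = κ / 2 * j + -κ * j by ring, Real.exp_add, Real.exp_add]
        ring
    _ = _ := by
        rw [← ENNReal.ofReal_tsum_of_nonneg (fun j => by positivity)
          ((summable_geometric_of_lt_one (Real.exp_pos _).le hr).mul_left _), tsum_mul_left,
          tsum_geometric_of_lt_one (Real.exp_pos _).le hr, expMomentBound]

lemma ExpConcentrated.integrable_exp (hD : ExpConcentrated D A κ) (hκ : 0 < κ) :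
    Integrable (fun k => Real.exp (κ / 2 * |std D k|)) D := by
  refine ⟨Measurable.of_discrete.aestronglyMeasurable, ?_⟩
  rw [hasFiniteIntegral_iff_ofReal (Filter.Eventually.of_forall fun k => (Real.exp_pos _).le)]
  exact (hD.lintegral_exp_le hκ).trans_lt ENNReal.ofReal_lt_top

lemma ExpConcentrated.integral_exp_le (hD : ExpConcentrated D A κ) (hκ : 0 < κ) :
    ∫ k, Real.exp (κ / 2 * |std D k|) ∂D ≤ expMomentBound A κ := by
  rw [integral_eq_lintegral_of_nonneg_ae (Filter.Eventually.of_forall fun k => (Real.exp_pos _).le)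
    Measurable.of_discrete.aestronglyMeasurable]
  exact ENNReal.toReal_le_of_le_ofReal (expMomentBound_pos hκ).le (hD.lintegral_exp_le hκ)

lemma ExpConcentrated.integrable_of_le (hD : ExpConcentrated D A κ) (hκ : 0 < κ) (f : ℕ → ℝ)
    (C : ℝ) (h : ∀ k, |f k| ≤ C * Real.exp (κ / 2 * |std D k|)) : Integrable f D :=
  ((hD.integrable_exp hκ).const_mul C).mono' Measurable.of_discrete.aestronglyMeasurable
    (Filter.Eventually.of_forall h)

lemma ExpConcentrated.integral_le_of_le (hD : ExpConcentrated D A κ) (hκ : 0 < κ) (f : ℕ → ℝ)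
    (C : ℝ) (hC : 0 ≤ C) (h : ∀ k, |f k| ≤ C * Real.exp (κ / 2 * |std D k|)) :
    ∫ k, f k ∂D ≤ C * expMomentBound A κ :=
  calc ∫ k, f k ∂D ≤ ∫ k, C * Real.exp (κ / 2 * |std D k|) ∂D :=
        integral_mono (hD.integrable_of_le hκ f C h) ((hD.integrable_exp hκ).const_mul C)
          fun k => (le_abs_self _).trans (h k)
    _ = C * ∫ k, Real.exp (κ / 2 * |std D k|) ∂D := integral_const_mul _ _
    _ ≤ _ := by gcongr; exact hD.integral_exp_le hκ

lemma ExpConcentrated.integrable_std (hD : ExpConcentrated D A κ) : Integrable (std D) D :=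
  ((hD.memLp.integrable one_le_two).sub (integrable_const _)).div_const _

lemma ExpConcentrated.integral_std (hD : ExpConcentrated D A κ) : ∫ k, std D k ∂D = 0 := by
  simp only [std]
  rw [integral_div, integral_sub (hD.memLp.integrable one_le_two) (integrable_const _)]
  simp [mean]

lemma ExpConcentrated.integral_std_sq (hD : ExpConcentrated D A κ) (hκ : 0 < κ) :
    ∫ k, std D k ^ 2 ∂D = 1 := by
  have hs := hD.sd_pos hκ
  simp only [std, div_pow]
  rw [integral_div]
  have h1 : sd D ^ 2 = ∫ k : ℕ, ((k : ℝ) - mean D) ^ 2 ∂D := by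
    rw [sd, Real.sq_sqrt (variance_nonneg _ _), variance_eq_integral
      Measurable.of_discrete.aemeasurable]
    rfl
  rw [← h1, div_self (by positivity)]

lemma sq_le_exp (hκ : 0 < κ) (z : ℝ) : z ^ 2 ≤ 32 / κ ^ 2 * Real.exp (κ / 4 * |z|) := by
  have h := Real.pow_div_factorial_le_exp (x := κ / 4 * |z|) (by positivity) 2
  rw [mul_pow, sq_abs] at h
  norm_num at h
  calc z ^ 2 = 32 / κ ^ 2 * ((κ / 4) ^ 2 * z ^ 2 / 2) := by field_simp; ring
    _ ≤ _ := by gcongr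

lemma pow_four_le_exp (hκ : 0 < κ) (z : ℝ) : z ^ 4 ≤ 384 / κ ^ 4 * Real.exp (κ / 2 * |z|) := by
  have h := Real.pow_div_factorial_le_exp (x := κ / 2 * |z|) (by positivity) 4
  rw [mul_pow, Even.pow_abs (by decide)] at h
  norm_num [Nat.factorial] at h
  calc z ^ 4 = 384 / κ ^ 4 * ((κ / 2) ^ 4 * z ^ 4 / 24) := by field_simp; ring
    _ ≤ _ := by gcongr

lemma exp_le_one_add_add (y : ℝ) : Real.exp y ≤ 1 + y + y ^ 2 * Real.exp |y| := by
  have h := Complex.norm_exp_sub_sum_le_norm_mul_exp (y : ℂ) 2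
  have h2 : (Complex.exp y - ∑ m ∈ Finset.range 2, (y : ℂ) ^ m / (m.factorial : ℂ))
      = ((Real.exp y - 1 - y : ℝ) : ℂ) := by
    simp [Finset.sum_range_succ]; ring
  rw [h2, Complex.norm_real, Complex.norm_real, Real.norm_eq_abs, Real.norm_eq_abs, sq_abs] at h
  linarith [le_abs_self (Real.exp y - 1 - y)]

/-- The constant in the bound for the moment generating function. -/
noncomputable def mgfConst (A κ : ℝ) : ℝ := 32 / κ ^ 2 * expMomentBound A κ

/-- The available rate `κ / 2` is split evenly: one half absorbs the square, the other the
exponential. -/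
lemma ExpConcentrated.sq_mul_exp_le (hκ : 0 < κ) {θ : ℝ} (hθ : |θ| ≤ κ / 4) (z : ℝ) :
    z ^ 2 * Real.exp |θ * z| ≤ 32 / κ ^ 2 * Real.exp (κ / 2 * |z|) := by
  calc z ^ 2 * Real.exp |θ * z|
      ≤ (32 / κ ^ 2 * Real.exp (κ / 4 * |z|)) * Real.exp (κ / 4 * |z|) := by
        gcongr
        · exact sq_le_exp hκ z
        · rw [abs_mul]; gcongr
    _ = _ := by
        rw [mul_assoc, ← Real.exp_add]; congr 2; ring

lemma ExpConcentrated.integrable_exp_mul (hD : ExpConcentrated D A κ) (hκ : 0 < κ) {θ : ℝ}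
    (hθ : |θ| ≤ κ / 4) : Integrable (fun k => Real.exp (θ * std D k)) D := by
  refine hD.integrable_of_le hκ _ 1 fun k => ?_
  rw [abs_of_pos (Real.exp_pos _), one_mul]
  apply Real.exp_le_exp.2
  calc θ * std D k ≤ |θ| * |std D k| := by rw [← abs_mul]; exact le_abs_self _
    _ ≤ κ / 2 * |std D k| := by gcongr; linarith

/-- Second order Taylor expansion: the linear term vanishes because `std D` has mean zero, and the
remainder is controlled by the exponential moment. -/
lemma ExpConcentrated.integral_exp_mul_le (hD : ExpConcentrated D A κ) (hκ : 0 < κ) {θ : ℝ}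
    (hθ : |θ| ≤ κ / 4) : ∫ k, Real.exp (θ * std D k) ∂D ≤ Real.exp (mgfConst A κ * θ ^ 2) := by
  have hsq : ∀ k, |std D k ^ 2 * Real.exp (|θ * std D k|)|
      ≤ 32 / κ ^ 2 * Real.exp (κ / 2 * |std D k|) := fun k => by
    rw [abs_of_nonneg (by positivity)]; exact ExpConcentrated.sq_mul_exp_le hκ hθ _
  have hi := (hD.integrable_of_le hκ _ _ hsq).const_mul (θ ^ 2)
  have hl : Integrable (fun k => 1 + θ * std D k) D :=
    (integrable_const (1 : ℝ)).add (hD.integrable_std.const_mul θ)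
  calc ∫ k, Real.exp (θ * std D k) ∂D
      ≤ ∫ k, ((1 + θ * std D k) + θ ^ 2 * (std D k ^ 2 * Real.exp |θ * std D k|)) ∂D := by
        refine integral_mono (hD.integrable_exp_mul hκ hθ) (hl.add hi) fun k => ?_
        refine (exp_le_one_add_add _).trans (le_of_eq ?_)
        ring
    _ = 1 + θ ^ 2 * ∫ k, std D k ^ 2 * Real.exp |θ * std D k| ∂D := by
        rw [integral_add hl hi, integral_add (integrable_const _) (hD.integrable_std.const_mul θ),
          integral_const_mul, integral_const_mul, hD.integral_std]
        simp
    _ ≤ 1 + θ ^ 2 * mgfConst A κ := by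
        gcongr
        exact hD.integral_le_of_le hκ _ _ (by positivity) hsq
    _ ≤ _ := by
        rw [mul_comm (mgfConst A κ)]
        linarith [Real.add_one_le_exp (θ ^ 2 * mgfConst A κ)]

/-- Exponential moments of weighted sums of independent loads. -/
theorem ExpConcentrated.lintegral_exp_sum_le (hD : ExpConcentrated D A κ) (hκ : 0 < κ)
    (b : Fin n → ℝ) (hb : sd D ^ 2 * ∑ w, b w ^ 2 ≤ (κ / 4) ^ 2) :
    ∫⁻ x : Fin n → ℕ, ENNReal.ofReal (Real.exp (∑ w, b w * ((x w : ℝ) - mean D)))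
      ∂(Measure.pi fun _ => D) ≤ ENNReal.ofReal (Real.exp (mgfConst A κ * (κ / 4) ^ 2)) := by
  have hs := hD.sd_pos hκ
  -- The bound on the sum of squares bounds every single coefficient, which puts all factors in the
  -- range of the moment generating function estimate.
  have hθ : ∀ w, |b w * sd D| ≤ κ / 4 := by
    intro w
    refine abs_le_of_sq_le_sq ?_ (by positivity)
    refine le_trans ?_ hb
    rw [mul_pow, mul_comm]
    gcongr
    exact Finset.single_le_sum (f := fun w => b w ^ 2) (fun i _ => sq_nonneg _) (Finset.mem_univ w)
  have h1 : ∀ x : Fin n → ℕ, Real.exp (∑ w, b w * ((x w : ℝ) - mean D))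
      = ∏ w, Real.exp (b w * sd D * std D (x w)) := by
    intro x
    rw [← Real.exp_sum]
    congr 1
    refine Finset.sum_congr rfl fun w _ => ?_
    rw [std]; field_simp
  have hint : Integrable (fun x : Fin n → ℕ => ∏ w, Real.exp (b w * sd D * std D (x w)))
      (Measure.pi fun _ => D) :=
    Integrable.fintype_prod (f := fun w k => Real.exp (b w * sd D * std D k))
      fun w => hD.integrable_exp_mul hκ (hθ w)
  simp only [h1]
  rw [← ofReal_integral_eq_lintegral_ofReal hint (Filter.Eventually.of_forall fun x =>
    Finset.prod_nonneg fun w _ => (Real.exp_pos _).le)]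
  apply ENNReal.ofReal_le_ofReal
  rw [integral_fintype_prod_eq_prod (fun w k => Real.exp (b w * sd D * std D k))]
  calc ∏ w, ∫ k, Real.exp (b w * sd D * std D k) ∂D
      ≤ ∏ w, Real.exp (mgfConst A κ * (b w * sd D) ^ 2) :=
        Finset.prod_le_prod (fun w _ => integral_nonneg fun k => (Real.exp_pos _).le)
          fun w _ => hD.integral_exp_mul_le hκ (hθ w)
    _ = Real.exp (mgfConst A κ * (sd D ^ 2 * ∑ w, b w ^ 2)) := by
        rw [← Real.exp_sum]
        congr 1
        rw [Finset.mul_sum, Finset.mul_sum]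
        exact Finset.sum_congr rfl fun w _ => by ring
    _ ≤ _ := by
        apply Real.exp_le_exp.2
        have : 0 ≤ mgfConst A κ := mul_nonneg (by positivity) (expMomentBound_pos hκ).le
        gcongr

/-- Pairs of loads whose difference is of the order of the standard deviation. -/
def spread (D : Measure ℕ) (C : ℝ) : Set (ℕ × ℕ) :=
  {z | sd D ≤ |(z.1 : ℝ) - z.2| ∧ |(z.1 : ℝ) - z.2| ≤ C * sd D}

/-- Two independent loads differ by the order of the standard deviation, with a probability that
depends on `A` and `κ` only. -/
theorem exists_spread (A κ : ℝ) (hκ : 0 < κ) : ∃ C p : ℝ, 0 < C ∧ 0 < p ∧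
    ∀ (D : Measure ℕ) [IsProbabilityMeasure D], ExpConcentrated D A κ →
      p ≤ (D.prod D).real (spread D C) := by
  have hB := expMomentBound_pos (A := A) hκ
  set C4 : ℝ := 384 / κ ^ 4 * expMomentBound A κ with hC4
  have hC4pos : 0 < C4 := by positivity
  have hpos : 0 < 1 / (64 * C4) := by positivity
  suffices h : ∀ (D : Measure ℕ) [IsProbabilityMeasure D], ExpConcentrated D A κ →
      1 / (64 * C4) ≤ (D.prod D).real (spread D √(32 * C4)) from
    ⟨√(32 * C4), 1 / (64 * C4), Real.sqrt_pos.2 (by positivity), hpos, fun D _ hD => h D hD⟩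
  intro D _ hD
  have hs := hD.sd_pos hκ
  -- With `C ^ 2 = 32 * C4` the fourth moments below contribute at most `1 / 2`, leaving `2 ≤ 3 / 2
  -- + C ^ 2 * P` for the probability `P` of `spread D C`, that is `P ≥ 1 / (64 * C4)`.
  set C := √(32 * C4) with hC
  have hCsq : C ^ 2 = 32 * C4 := Real.sq_sqrt (by positivity)
  have hCpos : 0 < C := Real.sqrt_pos.2 (by positivity)
  have h4 : ∀ k, |std D k ^ 4| ≤ 384 / κ ^ 4 * Real.exp (κ / 2 * |std D k|) := fun k => by
    rw [abs_of_nonneg (by positivity)]; exact pow_four_le_exp hκ _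
  have h2 : ∀ k, |std D k ^ 2| ≤ 32 / κ ^ 2 * Real.exp (κ / 2 * |std D k|) := fun k => by
    rw [abs_of_nonneg (by positivity)]
    refine (sq_le_exp hκ _).trans ?_
    gcongr
    norm_num
  have i4 := hD.integrable_of_le hκ _ _ h4
  have i2 := hD.integrable_of_le hκ _ _ h2
  have i1 := hD.integrable_std
  have e4 : ∫ k, std D k ^ 4 ∂D ≤ C4 := hD.integral_le_of_le hκ _ _ (by positivity) h4
  have e2 := hD.integral_std_sq hκ
  have e1 := hD.integral_std
  have hd : ∀ z : ℕ × ℕ, (z.1 : ℝ) - z.2 = sd D * (std D z.1 - std D z.2) := fun z => by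
    simp only [std]; field_simp; ring
  -- The square of the standardized difference is at most `1` below the range of `spread`, at most
  -- `C ^ 2` inside it, and beyond it at most `|a - b| ^ 4 / C ^ 2 ≤ 8 (a ^ 4 + b ^ 4) / C ^ 2`.
  have hpt : ∀ z : ℕ × ℕ, std D z.1 ^ 2 + std D z.2 ^ 2 - 2 * (std D z.1 * std D z.2)
      ≤ 1 + C ^ 2 * (spread D C).indicator (fun _ => (1 : ℝ)) z
        + (8 / C ^ 2) * (std D z.1 ^ 4 + std D z.2 ^ 4) := by
    intro z
    set a := std D z.1 with ha
    set b := std D z.2 with hb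
    have hab : a ^ 2 + b ^ 2 - 2 * (a * b) = |a - b| ^ 2 := by rw [sq_abs]; ring
    have hind : 0 ≤ (spread D C).indicator (fun _ => (1 : ℝ)) z :=
      Set.indicator_nonneg (fun _ _ => zero_le_one) _
    have h8 : 0 ≤ (8 / C ^ 2) * (a ^ 4 + b ^ 4) := by positivity
    rw [hab]
    by_cases hlt : |a - b| < 1
    · have : |a - b| ^ 2 ≤ 1 := by nlinarith [abs_nonneg (a - b)]
      have : 0 ≤ C ^ 2 * (spread D C).indicator (fun _ => (1 : ℝ)) z := by positivity
      linarith
    by_cases hgt : |a - b| ≤ C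
    · have hz : z ∈ spread D C := by
        simp only [spread, Set.mem_ofPred_eq, hd, abs_mul, abs_of_pos hs]
        constructor
        · nlinarith [not_lt.1 hlt]
        · nlinarith
      rw [Set.indicator_of_mem hz, mul_one]
      have : |a - b| ^ 2 ≤ C ^ 2 := by gcongr
      linarith
    · have h3 : |a - b| ^ 2 ≤ (8 / C ^ 2) * (a ^ 4 + b ^ 4) := by
        rw [div_mul_eq_mul_div, le_div_iff₀ (by positivity)]
        have : |a - b| ^ 2 * C ^ 2 ≤ |a - b| ^ 2 * |a - b| ^ 2 := by
          gcongr
          exact (not_le.1 hgt).le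
        refine this.trans ?_
        rw [sq_abs]
        nlinarith [sq_nonneg (a + b), sq_nonneg (a ^ 2 - b ^ 2), sq_nonneg (a - b),
          mul_nonneg (sq_nonneg (a + b)) (sq_nonneg (a - b)), sq_nonneg ((a + b) ^ 2),
          sq_nonneg (a * b), mul_nonneg (sq_nonneg (a + b)) (sq_nonneg (a + b))]
      have : 0 ≤ C ^ 2 * (spread D C).indicator (fun _ => (1 : ℝ)) z := by positivity
      linarith
  have j2a : Integrable (fun z : ℕ × ℕ => std D z.1 ^ 2) (D.prod D) := i2.comp_fst D
  have j2b : Integrable (fun z : ℕ × ℕ => std D z.2 ^ 2) (D.prod D) := i2.comp_snd D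
  have j4a : Integrable (fun z : ℕ × ℕ => std D z.1 ^ 4) (D.prod D) := i4.comp_fst D
  have j4b : Integrable (fun z : ℕ × ℕ => std D z.2 ^ 4) (D.prod D) := i4.comp_snd D
  have j1 : Integrable (fun z : ℕ × ℕ => std D z.1 * std D z.2) (D.prod D) := i1.mul_prod i1
  have jI : Integrable ((spread D C).indicator fun _ => (1 : ℝ)) (D.prod D) :=
    (integrable_const _).indicator MeasurableSet.of_discrete
  have k2 : Integrable (fun z : ℕ × ℕ => std D z.1 ^ 2 + std D z.2 ^ 2) (D.prod D) := j2a.add j2b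
  have k4 : Integrable (fun z : ℕ × ℕ => (8 / C ^ 2) * (std D z.1 ^ 4 + std D z.2 ^ 4))
    (D.prod D) := (j4a.add j4b).const_mul _
  have kI : Integrable (fun z : ℕ × ℕ => 1 + C ^ 2 * (spread D C).indicator (fun _ => (1 : ℝ)) z)
    (D.prod D) := (integrable_const (1 : ℝ)).add (jI.const_mul (C ^ 2))
  have key := integral_mono (k2.sub (j1.const_mul 2)) (kI.add k4) hpt
  have l1 : ∫ z : ℕ × ℕ, (std D z.1 ^ 2 + std D z.2 ^ 2 - 2 * (std D z.1 * std D z.2))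
      ∂(D.prod D) = 2 := by
    rw [integral_sub k2 (j1.const_mul 2), integral_add j2a j2b, integral_const_mul,
      integral_prod_mul (std D) (std D), e1, integral_fun_fst (fun k => std D k ^ 2),
      integral_fun_snd (fun k => std D k ^ 2), e2]
    simp; norm_num
  have l2 : ∫ z : ℕ × ℕ, (1 + C ^ 2 * (spread D C).indicator (fun _ => (1 : ℝ)) z
        + (8 / C ^ 2) * (std D z.1 ^ 4 + std D z.2 ^ 4)) ∂(D.prod D)
      = 1 + C ^ 2 * (D.prod D).real (spread D C) + (8 / C ^ 2) * (2 * ∫ k, std D k ^ 4 ∂D) := by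
    rw [integral_add kI k4, integral_add (integrable_const _)
      (jI.const_mul (C ^ 2)), integral_const_mul, integral_const_mul, integral_add j4a j4b,
      integral_fun_fst (fun k => std D k ^ 4), integral_fun_snd (fun k => std D k ^ 4),
      integral_indicator_const _ MeasurableSet.of_discrete]
    simp; left; ring
  have key' : (2 : ℝ) ≤ 1 + C ^ 2 * (D.prod D).real (spread D C)
      + (8 / C ^ 2) * (2 * ∫ k, std D k ^ 4 ∂D) := by
    rw [← l2]; exact l1.symm.le.trans key
  rw [hCsq] at key'
  have h5 : (8 / (32 * C4)) * (2 * ∫ k, std D k ^ 4 ∂D) ≤ 1 / 2 := by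
    calc _ ≤ (8 / (32 * C4)) * (2 * C4) := by gcongr
      _ = 1 / 2 := by field_simp; norm_num
  rw [div_le_iff₀ (by positivity)]
  linarith

end Distribution

/-! ### The upper bounds -/

section Upper

variable {D : Measure ℕ} [IsProbabilityMeasure D] {A κ : ℝ}

/-- Chernoff's bound for a linear functional of the load vector. -/
theorem ExpConcentrated.loadLaw_pairing_le (hD : ExpConcentrated D A κ) (hκ : 0 < κ)
    (m : ℕ → Matching n) (s : ℕ) (a : Fin n → ℝ) (ha : ∑ u, a u = 0)
    (hb : sd D ^ 2 * ∑ w, pull m s a w ^ 2 ≤ (κ / 4) ^ 2) (T : ℝ) :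
    loadLaw D m s {x | T ≤ pairing a x}
      ≤ ENNReal.ofReal (Real.exp ((∑ u, a u ^ 2) / 4 + mgfConst A κ * (κ / 4) ^ 2 - T)) := by
  rw [loadLaw_apply]
  have h1 : ∀ x₀ : Fin n → ℕ, (run m (fun u => (x₀ u : ℤ)) s).toMeasure {x | T ≤ pairing a x}
      ≤ ENNReal.ofReal (Real.exp (∑ w, pull m s a w * ((x₀ w : ℝ) - mean D)))
        * ENNReal.ofReal (Real.exp ((∑ u, a u ^ 2) / 4 - T)) := by
    intro x₀
    refine (toMeasure_le_expect _ _ (fun y => ENNReal.ofReal (Real.exp (pairing a y))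
      * ENNReal.ofReal (Real.exp (-T))) ?_).trans ?_
    · intro x hx
      rw [← ENNReal.ofReal_mul (Real.exp_pos _).le, ← Real.exp_add, ← ENNReal.ofReal_one]
      apply ENNReal.ofReal_le_ofReal
      rw [Real.one_le_exp_iff]
      have hx' : T ≤ pairing a x := hx
      linarith
    · rw [expect_mul_const]
      refine (mul_le_mul_left (expect_run_le m _ s a) _).trans (le_of_eq ?_)
      rw [mul_assoc, ← ENNReal.ofReal_mul (Real.exp_pos _).le, ← Real.exp_add, ← sub_eq_add_neg]
      congr 3
      -- Since `a` sums to zero, so does `pull m s a`, and the loads may be centred at their mean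
      -- for free.
      simp only [pairing, mul_sub, Finset.sum_sub_distrib, ← Finset.sum_mul, sum_pull, ha,
        Int.cast_natCast]
      ring_nf
  calc _ ≤ ∫⁻ x₀ : Fin n → ℕ, ENNReal.ofReal (Real.exp (∑ w, pull m s a w * ((x₀ w : ℝ) - mean D)))
        * ENNReal.ofReal (Real.exp ((∑ u, a u ^ 2) / 4 - T)) ∂(Measure.pi fun _ => D) :=
        lintegral_mono h1
    _ ≤ ENNReal.ofReal (Real.exp (mgfConst A κ * (κ / 4) ^ 2))
        * ENNReal.ofReal (Real.exp ((∑ u, a u ^ 2) / 4 - T)) := by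
        rw [lintegral_mul_const _ Measurable.of_discrete]
        gcongr
        exact hD.lintegral_exp_sum_le hκ _ hb
    _ = _ := by
        rw [← ENNReal.ofReal_mul (Real.exp_pos _).le, ← Real.exp_add]
        congr 2; ring

lemma exists_disc_eq (hn : 0 < n) (x : Fin n → ℤ) : ∃ u v, disc x = x u - x v := by
  have : Nonempty (Fin n) := ⟨⟨0, hn⟩⟩
  obtain ⟨u, hu⟩ := exists_eq_ciSup_of_finite (f := x)
  obtain ⟨v, hv⟩ := exists_eq_ciInf_of_finite (f := x)
  exact ⟨u, v, by rw [disc, hu, hv]⟩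

lemma sub_le_disc (x : Fin n → ℤ) (u v : Fin n) : x u - x v ≤ disc x :=
  sub_le_sub (le_ciSup (Set.finite_range x).bddAbove u) (ciInf_le (Set.finite_range x).bddBelow v)

lemma pairing_smul_single_sub (θ : ℝ) (u v : Fin n) (x : Fin n → ℤ) :
    pairing (θ • (Pi.single u 1 - Pi.single v 1)) x = θ * ((x u : ℝ) - x v) := by
  simp only [pairing, Pi.smul_apply, Pi.sub_apply, smul_eq_mul, mul_assoc, ← Finset.mul_sum,
    sub_mul, Finset.sum_sub_distrib]
  simp [Pi.single_apply]

lemma sum_single_sub (u v : Fin n) :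
    ∑ w, (Pi.single u 1 - Pi.single v 1 : Fin n → ℝ) w = 0 := by
  simp [Pi.single_apply]

lemma sum_sq_single_sub_le (u v : Fin n) :
    ∑ w, (Pi.single u 1 - Pi.single v 1 : Fin n → ℝ) w ^ 2 ≤ 2 := by
  calc ∑ w, (Pi.single u 1 - Pi.single v 1 : Fin n → ℝ) w ^ 2
      ≤ ∑ w, ((Pi.single u 1 : Fin n → ℝ) w + (Pi.single v 1 : Fin n → ℝ) w) := by
        refine Finset.sum_le_sum fun w _ => ?_
        simp only [Pi.sub_apply, Pi.single_apply]
        split_ifs <;> norm_num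
    _ = 2 := by simp [Finset.sum_add_distrib, Pi.single_apply]; norm_num

/-- The discrepancy is small if the rows of the matrix of the process are close to each other. -/
theorem exists_disc_upper (A κ : ℝ) (hκ : 0 < κ) : ∃ K : ℝ, 0 < K ∧
    ∀ (D : Measure ℕ) [IsProbabilityMeasure D], ExpConcentrated D A κ →
      ∀ (n : ℕ) (m : ℕ → Matching n) (s : ℕ) (ρ : ℝ), 0 < n → 0 ≤ ρ →
        (∀ u v, ∑ w, pull m s (Pi.single u 1 - Pi.single v 1) w ^ 2 ≤ 4 * ρ ^ 2) →
        1 - K / (n : ℝ) ≤ (loadLaw D m s).real {x | (disc x : ℝ) ≤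
          K * (ρ * sd D * Real.log n ^ (3 / 2 : ℝ) + √(Real.log n))} := by
  set B := mgfConst A κ * (κ / 4) ^ 2 with hB
  have hBpos := Real.exp_pos B
  have hκ' : 0 < 28 / κ := by positivity
  -- The three summands serve the two choices of `θ` below and the final union bound; the first also
  -- makes the claim trivial for `n < 3`.
  refine ⟨4 + 28 / κ + Real.exp B, by positivity, ?_⟩
  set K := 4 + 28 / κ + Real.exp B with hK
  intro D _ hD n m s ρ hn hρ hm
  have hn' : (0 : ℝ) < n := by exact_mod_cast hn
  rcases Nat.lt_or_ge n 3 with h3 | h3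
  · have : (n : ℝ) ≤ 2 := by exact_mod_cast Nat.lt_succ_iff.1 h3
    have : 1 ≤ K / (n : ℝ) := by rw [le_div_iff₀ hn']; linarith
    have h0 := measureReal_nonneg (μ := loadLaw D m s) (s := {x | (disc x : ℝ) ≤
          K * (ρ * sd D * Real.log n ^ (3 / 2 : ℝ) + √(Real.log n))})
    linarith
  have h3' : (3 : ℝ) ≤ n := by exact_mod_cast h3
  set L := Real.log n with hL
  have hL1 : 1 ≤ L := by
    rw [hL, Real.le_log_iff_exp_le hn']
    linarith [Real.exp_one_lt_d9]
  have hL0 : 0 ≤ L := by linarith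
  have hσ := hD.sd_pos hκ
  set σ := sd D with hσdef
  set T := K * (ρ * σ * L ^ (3 / 2 : ℝ) + √L) with hT
  have hL32 : L ≤ L ^ (3 / 2 : ℝ) := by
    conv_lhs => rw [← Real.rpow_one L]
    exact Real.rpow_le_rpow_of_exponent_le hL1 (by norm_num)
  have hsL : √L * √L = L := Real.mul_self_sqrt hL0
  have hsL0 : 0 ≤ √L := Real.sqrt_nonneg L
  -- the exponent of the Chernoff bound
  obtain ⟨θ, hθ0, hθ1, hθ2, hθ3⟩ : ∃ θ : ℝ, 0 < θ ∧ σ ^ 2 * (θ ^ 2 * (4 * ρ ^ 2)) ≤ (κ / 4) ^ 2 ∧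
      θ ^ 2 ≤ L ∧ 7 / 2 * L ≤ θ * T := by
    by_cases hc : √L * (2 * ρ * σ) ≤ κ / 4
    · refine ⟨√L, Real.sqrt_pos.2 (by linarith), ?_, by rw [sq, hsL], ?_⟩
      · calc σ ^ 2 * (√L ^ 2 * (4 * ρ ^ 2)) = (√L * (2 * ρ * σ)) ^ 2 := by ring
          _ ≤ _ := by gcongr
      · have h1 : √L * T = K * (√L * (ρ * σ * L ^ (3 / 2 : ℝ))) + K * L := by
          rw [hT]; linear_combination K * hsL
        have h2 : 0 ≤ K * (√L * (ρ * σ * L ^ (3 / 2 : ℝ))) := by positivity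
        have h4 : 7 / 2 * L ≤ K * L := by gcongr; linarith
        linarith
    · have hc' := not_le.1 hc
      have hρ0 : 0 < ρ := by
        rcases hρ.eq_or_lt with h | h
        · rw [← h] at hc'; simp at hc'; linarith
        · exact h
      refine ⟨κ / (8 * ρ * σ), by positivity, ?_, ?_, ?_⟩
      · apply le_of_eq; field_simp; norm_num
      · have : κ / (8 * ρ * σ) ≤ √L := by
          rw [div_le_iff₀ (by positivity)]; linarith
        calc (κ / (8 * ρ * σ)) ^ 2 ≤ √L ^ 2 := by gcongr
          _ = L := by rw [sq, hsL]
      · have h1 : κ / (8 * ρ * σ) * T = K * κ / 8 * L ^ (3 / 2 : ℝ)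
            + κ / (8 * ρ * σ) * (K * √L) := by
          rw [hT]; field_simp
        have h2 : 0 ≤ κ / (8 * ρ * σ) * (K * √L) := by positivity
        have h4 : 28 ≤ K * κ := by
          have : 28 / κ ≤ K := by linarith
          rwa [div_le_iff₀ hκ] at this
        have h5 : 7 / 2 * L ≤ K * κ / 8 * L ^ (3 / 2 : ℝ) :=
          mul_le_mul (by linarith) hL32 hL0 (by linarith)
        linarith
  -- The rounding error costs at most `θ ^ 2 / 2 ≤ L / 2`, so the exponent is at most `B + L / 2 - 7
  -- / 2 * L = B - 3 * L`. The factor `n⁻³` survives a union over `n ^ 2` pairs.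
  have hpair : ∀ u v : Fin n, loadLaw D m s {x | T < (x u : ℝ) - x v}
      ≤ ENNReal.ofReal (Real.exp B / (n : ℝ) ^ 3) := by
    intro u v
    have h1 : {x : Fin n → ℤ | T < (x u : ℝ) - x v}
        ⊆ {x | θ * T ≤ pairing (θ • (Pi.single u 1 - Pi.single v 1)) x} := by
      intro x hx
      have hx' : T < (x u : ℝ) - x v := hx
      simp only [Set.mem_ofPred_eq, pairing_smul_single_sub]
      exact (mul_lt_mul_of_pos_left hx' hθ0).le
    refine (measure_mono h1).trans ((hD.loadLaw_pairing_le hκ m s _ ?_ ?_ _).trans ?_)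
    · simp only [Pi.smul_apply, smul_eq_mul, ← Finset.mul_sum, sum_single_sub, mul_zero]
    · rw [pull_smul]
      simp only [Pi.smul_apply, smul_eq_mul, mul_pow, ← Finset.mul_sum]
      refine le_trans ?_ hθ1
      gcongr
      exact hm u v
    · apply ENNReal.ofReal_le_ofReal
      have h3 : Real.exp B / (n : ℝ) ^ 3 = Real.exp (B - 3 * L) := by
        rw [Real.exp_sub, show 3 * L = ((3 : ℕ) : ℝ) * L by norm_num, Real.exp_nat_mul, hL,
          Real.exp_log hn']
      rw [h3]
      apply Real.exp_le_exp.2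
      simp only [Pi.smul_apply, smul_eq_mul, mul_pow, ← Finset.mul_sum]
      have h2 := sum_sq_single_sub_le u v
      have h4 : θ ^ 2 * ∑ w, (Pi.single u 1 - Pi.single v 1 : Fin n → ℝ) w ^ 2 ≤ L * 2 := by
        gcongr
      linarith
  have hcompl : {x : Fin n → ℤ | (disc x : ℝ) ≤ T}ᶜ
      ⊆ ⋃ u : Fin n, ⋃ v : Fin n, {x : Fin n → ℤ | T < (x u : ℝ) - x v} := by
    intro x hx
    have hx' : T < (disc x : ℝ) := not_le.1 hx
    obtain ⟨u, v, huv⟩ := exists_disc_eq hn x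
    rw [huv] at hx'
    push_cast at hx'
    exact Set.mem_iUnion.2 ⟨u, Set.mem_iUnion.2 ⟨v, hx'⟩⟩
  have hbad : loadLaw D m s {x : Fin n → ℤ | (disc x : ℝ) ≤ T}ᶜ
      ≤ ENNReal.ofReal (Real.exp B / n) := by
    refine (measure_mono hcompl).trans ((measure_iUnion_fintype_le _ _).trans ?_)
    calc _ ≤ ∑ u : Fin n, ∑ v : Fin n, ENNReal.ofReal (Real.exp B / (n : ℝ) ^ 3) :=
          Finset.sum_le_sum fun u _ => (measure_iUnion_fintype_le _ _).trans
            (Finset.sum_le_sum fun v _ => hpair u v)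
      _ = _ := by
          simp only [Finset.sum_const, Finset.card_univ, Fintype.card_fin, nsmul_eq_mul]
          rw [← ENNReal.ofReal_natCast, ← ENNReal.ofReal_mul hn'.le, ← ENNReal.ofReal_mul hn'.le]
          congr 1; field_simp
  have h5 := ENNReal.toReal_le_of_le_ofReal (by positivity) hbad
  have h6 := probReal_compl_eq_one_sub (μ := loadLaw D m s)
    (s := {x : Fin n → ℤ | (disc x : ℝ) ≤ T}) MeasurableSet.of_discrete
  rw [measureReal_def] at h6
  rw [h6] at h5
  have h7 : Real.exp B / n ≤ K / n := by gcongr; linarith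
  linarith

end Upper

/-! ### The second eigenvalue -/

section Spectral

variable {A : Matrix (Fin n) (Fin n) ℝ}

/-- Apart from one, all eigenvalues are bounded by the second one, which is an eigenvalue. -/
lemma exists_index_secondAbsEigenvalue (hA : A.IsHermitian) (hn : 2 ≤ n) :
    (∃ i₀, ∀ i, i ≠ i₀ → |hA.eigenvalues i| ≤ secondAbsEigenvalue hA) ∧
      ∃ j, secondAbsEigenvalue hA = |hA.eigenvalues j| := by
  set f : Fin n → ℝ := fun i => |hA.eigenvalues i| with hf
  set S : Multiset ℝ := Finset.univ.val.map f with hS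
  set l := Multiset.sort S (· ≥ ·) with hl
  have hsort : l.Pairwise (· ≥ ·) := Multiset.pairwise_sort S (· ≥ ·)
  have hlS : (l : Multiset ℝ) = S := Multiset.sort_eq S (· ≥ ·)
  have hlen : l.length = n := by
    rw [hl, Multiset.length_sort, hS]; simp
  have hsec : secondAbsEigenvalue hA = l.getD 1 0 := rfl
  obtain ⟨a, b, t, habt⟩ : ∃ a b t, l = a :: b :: t := by
    match l, hlen with
    | [], h => simp at h; omega
    | [_], h => simp at h; omega
    | a :: b :: t, _ => exact ⟨a, b, t, rfl⟩
  have hb : secondAbsEigenvalue hA = b := by rw [hsec, habt]; rfl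
  rw [hb]
  rw [habt] at hsort hlS
  constructor
  · have hcard : S.countP (fun x => b < x) ≤ 1 := by
      rw [← hlS, Multiset.coe_countP, List.countP_cons, List.countP_cons]
      have h1 : t.countP (fun x => decide (b < x)) = 0 := by
        rw [List.countP_eq_zero]
        intro x hx
        have := (List.pairwise_cons.1 (List.pairwise_cons.1 hsort).2).1 x hx
        simpa using this
      rw [h1]
      simp only [lt_irrefl]
      split_ifs <;> simp_all
    rw [hS, Multiset.countP_map] at hcard
    have hcard' : (Finset.univ.filter fun i => b < f i).card ≤ 1 := hcard
    rw [Finset.card_le_one] at hcard'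
    by_cases h : ∃ i, b < f i
    · obtain ⟨i₀, hi₀⟩ := h
      refine ⟨i₀, fun i hi => ?_⟩
      by_contra hlt
      exact hi (hcard' i (by simpa using hlt) i₀ (by simpa using hi₀))
    · push Not at h
      exact ⟨⟨0, by omega⟩, fun i _ => h i⟩
  · have : b ∈ S := by rw [← hlS]; simp
    rw [hS, Multiset.mem_map] at this
    obtain ⟨j, -, hj⟩ := this
    exact ⟨j, hj.symm⟩

/-- The coordinates of a vector in the basis of eigenvectors. -/
noncomputable def eigCoord (hA : A.IsHermitian) (y : Fin n → ℝ) (j : Fin n) : ℝ :=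
  ∑ w, hA.eigenvectorBasis j w * y w

lemma inner_eq_eigCoord (hA : A.IsHermitian) (y : Fin n → ℝ) (j : Fin n) :
    inner ℝ (hA.eigenvectorBasis j) (WithLp.toLp 2 y) = eigCoord hA y j := by
  rw [PiLp.inner_apply]
  exact Finset.sum_congr rfl fun w _ => by simp [mul_comm]

lemma sum_eigCoord_mul (hA : A.IsHermitian) (y z : Fin n → ℝ) :
    ∑ j, eigCoord hA y j * eigCoord hA z j = ∑ w, y w * z w := by
  have h := hA.eigenvectorBasis.sum_inner_mul_inner (WithLp.toLp 2 y) (WithLp.toLp 2 z)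
  rw [PiLp.inner_apply] at h
  simp only [inner_eq_eigCoord, real_inner_comm (hA.eigenvectorBasis _)] at h
  rw [h]
  exact Finset.sum_congr rfl fun w _ => by simp [mul_comm]

lemma eigCoord_mulVec (hA : A.IsHermitian) (y : Fin n → ℝ) (j : Fin n) :
    eigCoord hA (A.mulVec y) j = hA.eigenvalues j * eigCoord hA y j := by
  have hT : A.transpose = A := by
    have := hA.eq
    rwa [Matrix.conjTranspose_eq_transpose_of_trivial] at this
  have h1 : eigCoord hA (A.mulVec y) j
      = dotProduct (A.mulVec (hA.eigenvectorBasis j).ofLp) y := by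
    have : eigCoord hA (A.mulVec y) j
      = dotProduct (hA.eigenvectorBasis j).ofLp (A.mulVec y) := rfl
    rw [this, Matrix.dotProduct_mulVec, ← Matrix.mulVec_transpose, hT]
  rw [h1, hA.mulVec_eigenvectorBasis, smul_dotProduct]
  rfl

lemma abs_eigenvalue_le_one (hA : A.IsHermitian)
    (hc : ∀ v, ∑ w, A.mulVec v w ^ 2 ≤ ∑ w, v w ^ 2) (j : Fin n) :
    |hA.eigenvalues j| ≤ 1 := by
  have h := hc (hA.eigenvectorBasis j).ofLp
  have h1 : ∑ w, (hA.eigenvectorBasis j).ofLp w ^ 2 = 1 := by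
    have h2 := hA.eigenvectorBasis.orthonormal.1 j
    have h3 := EuclideanSpace.real_norm_sq_eq (hA.eigenvectorBasis j)
    rw [h2] at h3
    linarith
  rw [hA.mulVec_eigenvectorBasis] at h
  simp only [Pi.smul_apply, smul_eq_mul, mul_pow, ← Finset.mul_sum, h1, mul_one] at h
  exact (sq_le_one_iff_abs_le_one _).1 h

/-- On the orthogonal complement of the constants, a symmetric contraction that fixes the constants
contracts by its second eigenvalue. -/
theorem sum_sq_mulVec_le (hA : A.IsHermitian) (hn : 2 ≤ n)
    (h1 : A.mulVec (fun _ => 1) = fun _ => 1)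
    (hc : ∀ v, ∑ w, A.mulVec v w ^ 2 ≤ ∑ w, v w ^ 2) (y : Fin n → ℝ) (hy : ∑ w, y w = 0) :
    ∑ w, A.mulVec y w ^ 2 ≤ secondAbsEigenvalue hA ^ 2 * ∑ w, y w ^ 2 := by
  obtain ⟨⟨i₀, hi₀⟩, j₀, hj₀⟩ := exists_index_secondAbsEigenvalue hA hn
  set μ := secondAbsEigenvalue hA with hμ
  have hμ0 : 0 ≤ μ := by rw [hj₀]; exact abs_nonneg _
  have hsq : ∀ z : Fin n → ℝ, ∑ w, z w ^ 2 = ∑ j, eigCoord hA z j ^ 2 := fun z => by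
    simp only [sq, sum_eigCoord_mul]
  rcases le_or_gt 1 μ with hge | hlt
  · refine (hc y).trans (le_mul_of_one_le_left (Finset.sum_nonneg fun w _ => sq_nonneg _) ?_)
    exact one_le_pow₀ hge
  -- If the second eigenvalue is below `1`, the constant vector, of eigenvalue `1`, is orthogonal to
  -- every eigenvector but the `i₀`-th. It is thus a nonzero multiple of that one, and `y` has no
  -- component there.
  have hone : ∀ j, j ≠ i₀ → eigCoord hA (fun _ => 1) j = 0 := by
    intro j hj
    have h2 := eigCoord_mulVec hA (fun _ => 1) j
    rw [h1] at h2
    have h3 : hA.eigenvalues j < 1 := (le_abs_self _).trans_lt ((hi₀ j hj).trans_lt hlt)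
    have h4 : (1 - hA.eigenvalues j) * eigCoord hA (fun _ => 1) j = 0 := by linarith
    rcases mul_eq_zero.1 h4 with h | h
    · linarith
    · exact h
  have hne : eigCoord hA (fun _ => 1) i₀ ≠ 0 := by
    intro h0
    have h2 := hsq (fun _ => 1)
    rw [Finset.sum_eq_zero (s := Finset.univ) (f := fun j => eigCoord hA (fun _ => 1) j ^ 2)] at h2
    · simp at h2; omega
    · intro j _
      by_cases hj : j = i₀
      · rw [hj, h0]; norm_num
      · rw [hone j hj]; norm_num
  have hy0 : eigCoord hA y i₀ = 0 := by
    have h2 := sum_eigCoord_mul hA y (fun _ => 1)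
    simp only [mul_one, hy] at h2
    rw [Finset.sum_eq_single i₀ (fun j _ hj => by rw [hone j hj, mul_zero]) (by simp)] at h2
    exact (mul_eq_zero.1 h2).resolve_right hne
  rw [hsq y, hsq (A.mulVec y), Finset.mul_sum]
  refine Finset.sum_le_sum fun j _ => ?_
  rw [eigCoord_mulVec, mul_pow]
  by_cases hj : j = i₀
  · rw [hj, hy0]; norm_num
  · gcongr ?_ * _
    rw [← sq_abs]
    have := hi₀ j hj
    gcongr

lemma sum_mul_sq_le (a b : Fin n → ℝ) :
    (∑ w, a w * b w) ^ 2 ≤ (∑ w, a w ^ 2) * ∑ w, b w ^ 2 :=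
  Finset.sum_mul_sq_le_sq_mul_sq _ _ _

lemma sum_mulVec_mul (M : Matrix (Fin n) (Fin n) ℝ) (a b : Fin n → ℝ) :
    ∑ w, M.mulVec a w * b w = ∑ w, a w * M.transpose.mulVec b w := by
  have : dotProduct (M.mulVec a) b = dotProduct a (M.transpose.mulVec b) := by
    rw [Matrix.mulVec_transpose, dotProduct_comm, Matrix.dotProduct_mulVec, dotProduct_comm]
  exact this

/-- The square of the norm of a vector orthogonal to the constants decreases by `λ`. -/
theorem lam_bounds (M : Matrix (Fin n) (Fin n) ℝ) (hn : 2 ≤ n)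
    (h1 : M.mulVec (fun _ => 1) = fun _ => 1)
    (h1' : M.transpose.mulVec (fun _ => 1) = fun _ => 1)
    (hc : ∀ v, ∑ w, M.mulVec v w ^ 2 ≤ ∑ w, v w ^ 2)
    (hc' : ∀ v, ∑ w, M.transpose.mulVec v w ^ 2 ≤ ∑ w, v w ^ 2) :
    0 ≤ lam M ∧ lam M ≤ 1 ∧ ∀ y : Fin n → ℝ, ∑ w, y w = 0 →
      ∑ w, M.mulVec y w ^ 2 ≤ lam M * ∑ w, y w ^ 2 := by
  by_cases h : M.IsHermitian
  · rw [lam, dif_pos h]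
    obtain ⟨-, j, hj⟩ := exists_index_secondAbsEigenvalue h hn
    have h0 : 0 ≤ secondAbsEigenvalue h := by rw [hj]; exact abs_nonneg _
    have hle : secondAbsEigenvalue h ≤ 1 := by rw [hj]; exact abs_eigenvalue_le_one h hc j
    refine ⟨h0, hle, fun y hy => (sum_sq_mulVec_le h hn h1 hc y hy).trans ?_⟩
    -- A symmetric matrix contracts squared norms even by the square; one factor is given up to have
    -- one statement for both cases.
    have : secondAbsEigenvalue h ^ 2 ≤ secondAbsEigenvalue h := by nlinarith
    exact mul_le_mul_of_nonneg_right this (Finset.sum_nonneg fun w _ => sq_nonneg _)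
  · rw [lam, dif_neg h]
    set hH := Matrix.isHermitian_mul_conjTranspose_self M
    have hH' : ∀ v, (M * M.conjTranspose).mulVec v = M.mulVec (M.transpose.mulVec v) := fun v => by
      rw [Matrix.conjTranspose_eq_transpose_of_trivial, Matrix.mulVec_mulVec]
    have hcH : ∀ v, ∑ w, (M * M.conjTranspose).mulVec v w ^ 2 ≤ ∑ w, v w ^ 2 := fun v => by
      rw [hH']; exact (hc _).trans (hc' v)
    obtain ⟨-, j, hj⟩ := exists_index_secondAbsEigenvalue hH hn
    have h0 : 0 ≤ secondAbsEigenvalue hH := by rw [hj]; exact abs_nonneg _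
    have hle : secondAbsEigenvalue hH ≤ 1 := by rw [hj]; exact abs_eigenvalue_le_one hH hcH j
    refine ⟨h0, hle, fun y hy => ?_⟩
    set μ := secondAbsEigenvalue hH
    set z := M.mulVec y with hz
    have hz0 : ∑ w, z w = 0 := by
      have := sum_mulVec_mul M y (fun _ => 1)
      simp only [h1', mul_one, hy] at this
      exact this
    have hHz := sum_sq_mulVec_le hH hn (by rw [hH', h1', h1]) hcH z hz0
    rw [hH'] at hHz
    set N := ∑ w, z w ^ 2 with hN
    set P := ∑ w, M.transpose.mulVec z w ^ 2 with hP
    set Y := ∑ w, y w ^ 2 with hY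
    have hN0 : 0 ≤ N := Finset.sum_nonneg fun w _ => sq_nonneg _
    have hP0 : 0 ≤ P := Finset.sum_nonneg fun w _ => sq_nonneg _
    have hY0 : 0 ≤ Y := Finset.sum_nonneg fun w _ => sq_nonneg _
    -- The eigenvalue belongs to `M Mᵀ`, while the norm of `z = M y` is wanted. Cauchy–Schwarz for
    -- `N = ⟨y, Mᵀ z⟩` gives `N ^ 2 ≤ Y * P`, and for `P = ⟨M Mᵀ z, z⟩` it gives `P ≤ μ * N`.
    have e1 : N ^ 2 ≤ Y * P := by
      have := sum_mul_sq_le y (M.transpose.mulVec z)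
      rw [← sum_mulVec_mul] at this
      simpa only [← hz, ← sq, ← hN] using this
    have e2 : P ^ 2 ≤ (μ * N) ^ 2 := by
      have h2 := sum_mul_sq_le (M.mulVec (M.transpose.mulVec z)) z
      rw [sum_mulVec_mul] at h2
      simp only [← sq, ← hP, ← hN] at h2
      calc P ^ 2 ≤ _ := h2
        _ ≤ μ ^ 2 * N * N := by gcongr
        _ = _ := by ring
    have e3 : P ≤ μ * N := by
      have := abs_le_of_sq_le_sq e2 (by positivity)
      exact (abs_le.1 this).2
    rcases hN0.eq_or_lt with hNz | hNpos
    · rw [← hNz]; positivity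
    · have : N * N ≤ μ * Y * N := by nlinarith
      exact le_of_mul_le_mul_right this hNpos

end Spectral

/-! ### Rows of the matrix of a circuit -/

lemma pull_eq_mulVec (m : ℕ → Matching n) (s : ℕ) (a : Fin n → ℝ) :
    pull m s a = (List.ofFn fun i : Fin s => (m i).matrix).prod.mulVec a := by
  induction s generalizing a with
  | zero => simp [pull]
  | succ s ih =>
    rw [pull, ih, List.ofFn_succ', List.concat_eq_append, List.prod_append, List.prod_singleton,
      ← Matrix.mulVec_mulVec, ← Matching.matrix_mulVec]
    rfl

lemma pull_comp (m : ℕ → Matching n) (s r : ℕ) (a : Fin n → ℝ) :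
    pull m (s + r) a = pull m s (pull (fun i => m (s + i)) r a) := by
  induction r generalizing a with
  | zero => rfl
  | succ r ih => rw [← Nat.add_assoc, pull, ih]; rfl

lemma sum_sq_pull_le (m : ℕ → Matching n) (s : ℕ) (a : Fin n → ℝ) :
    ∑ u, pull m s a u ^ 2 ≤ ∑ u, a u ^ 2 := by
  induction s generalizing a with
  | zero => rfl
  | succ s ih => exact (ih _).trans ((m s).sum_sq_avg_le a)

lemma sum_sq_push_le (m : ℕ → Matching n) (s : ℕ) (a : Fin n → ℝ) :
    ∑ u, push m s a u ^ 2 ≤ ∑ u, a u ^ 2 := by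
  induction s with
  | zero => rfl
  | succ s ih => exact ((m s).sum_sq_avg_le _).trans ih

lemma push_const (m : ℕ → Matching n) (s : ℕ) (c : ℝ) :
    push m s (fun _ => c) = fun _ => c := by
  induction s with
  | zero => rfl
  | succ s ih => rw [push, ih]; funext u; simp [Matching.avg]

lemma pull_const (m : ℕ → Matching n) (s : ℕ) (c : ℝ) :
    pull m s (fun _ => c) = fun _ => c := by
  induction s with
  | zero => rfl
  | succ s ih =>
    rw [pull]
    convert ih
    simp [Matching.avg]

variable {d : ℕ} (hd : 0 < d) (m : Fin d → Matching n)

lemma roundMatrix_mulVec (a : Fin n → ℝ) :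
    (roundMatrix m).mulVec a = pull (circuit hd m) d a := by
  rw [pull_eq_mulVec, roundMatrix]
  congr 4
  funext i
  simp only [circuit, Nat.mod_eq_of_lt i.isLt]

lemma roundMatrix_transpose_mulVec (b : Fin n → ℝ) :
    (roundMatrix m).transpose.mulVec b = push (circuit hd m) d b := by
  funext u
  have h := sum_mulVec_mul (roundMatrix m) (Pi.single u 1) b
  rw [roundMatrix_mulVec hd, sum_pull_mul] at h
  simpa [Pi.single_apply] using h.symm

lemma roundMatrix_lam_bounds (hn : 2 ≤ n) :
    0 ≤ lam (roundMatrix m) ∧ lam (roundMatrix m) ≤ 1 ∧ ∀ y : Fin n → ℝ, ∑ w, y w = 0 →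
      ∑ w, pull (circuit hd m) d y w ^ 2 ≤ lam (roundMatrix m) * ∑ w, y w ^ 2 := by
  have := lam_bounds (roundMatrix m) hn
  simp only [roundMatrix_mulVec hd, roundMatrix_transpose_mulVec hd] at this
  exact this (pull_const _ _ _) (push_const _ _ _) (sum_sq_pull_le _ _) (sum_sq_push_le _ _)

lemma sum_sq_pull_circuit_le (hn : 2 ≤ n) (t : ℕ) (y : Fin n → ℝ) (hy : ∑ w, y w = 0) :
    ∑ w, pull (circuit hd m) (d * t) y w ^ 2 ≤ lam (roundMatrix m) ^ t * ∑ w, y w ^ 2 := by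
  obtain ⟨h0, -, h2⟩ := roundMatrix_lam_bounds hd m hn
  induction t generalizing y with
  | zero => simp [pull]
  | succ t ih =>
    have hper : (fun i => circuit hd m (d * t + i)) = circuit hd m := by
      funext i; simp only [circuit, Nat.mul_add_mod]
    rw [Nat.mul_succ, pull_comp, hper, pow_succ, mul_assoc]
    refine (ih _ (by rw [sum_pull, hy])).trans ?_
    gcongr
    exact h2 y hy

/-- The rows of the matrix of the circuit after `t` rounds. -/
lemma sum_sq_pull_single_sub_circuit_le (t : ℕ) (u v : Fin n) :
    ∑ w, pull (circuit hd m) (d * t) (Pi.single u 1 - Pi.single v 1) w ^ 2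
      ≤ 4 * (lam (roundMatrix m) ^ ((t : ℝ) / 4)) ^ 2 := by
  -- Equal nodes are treated apart because distinct ones force `n ≥ 2`, which the spectral bound
  -- needs.
  by_cases huv : u = v
  · rw [huv, sub_self, pull_const (circuit hd m) (d * t) 0 |> (show pull (circuit hd m) (d * t) 0
      = fun _ => 0 from ·)]
    simp
    positivity
  have hn : 2 ≤ n := by
    have h1 := u.isLt
    have h2 := v.isLt
    have : u.val ≠ v.val := fun h => huv (Fin.ext h)
    omega
  obtain ⟨h0, hle, -⟩ := roundMatrix_lam_bounds hd m hn
  refine (sum_sq_pull_circuit_le hd m hn t _ (sum_single_sub u v)).trans ?_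
  have h2 := sum_sq_single_sub_le u v
  -- The right side is `λ ^ (t / 2)`, and `0 ≤ λ ≤ 1`.
  have h3 : lam (roundMatrix m) ^ t ≤ (lam (roundMatrix m) ^ ((t : ℝ) / 4)) ^ 2 := by
    rw [← Real.rpow_natCast _ 2, ← Real.rpow_mul h0, ← Real.rpow_natCast _ t]
    apply Real.rpow_le_rpow_of_exponent_ge' h0 hle (by positivity)
    push_cast
    have : (0 : ℝ) ≤ t := by positivity
    linarith
  have h4 : 0 ≤ lam (roundMatrix m) ^ t := by positivity
  calc _ ≤ lam (roundMatrix m) ^ t * 2 := by gcongr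
    _ ≤ _ := by linarith

/-! ### Rows of the matrix of dimension exchange -/

/-- The first `t` dimensions average over blocks of `2 ^ t` nodes that agree in all higher bits. In
the induction, flipping bit `t` exchanges the two blocks of size `2 ^ t` inside one of size `2 ^ (t
+ 1)`. -/
lemma pull_hypercube_le {k : ℕ} (hk : 0 < k) (t : ℕ) (ht : t ≤ k) (a : Fin (2 ^ k) → ℝ)
    (ha : ∀ v, 0 ≤ a v) (w : Fin (2 ^ k)) :
    pull (circuit hk (hypercube k)) t a w
      ≤ ((2 : ℝ) ^ t)⁻¹ * ∑ v, if v.val / 2 ^ t = w.val / 2 ^ t then a v else 0 := by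
  induction t generalizing a with
  | zero =>
    simp [pull, ← Fin.ext_iff]
  | succ t ih =>
    set p := circuit hk (hypercube k) t with hp
    have hpart : ∀ v, (p.partner v).val = v.val ^^^ 2 ^ t := fun v => by
      simp only [hp, circuit, hypercube, Nat.mod_eq_of_lt (Nat.lt_of_succ_le ht)]
    have hdiv : ∀ v, (p.partner v).val / 2 ^ t = (v.val / 2 ^ t) ^^^ 1 := fun v => by
      rw [hpart, ← Nat.shiftRight_eq_div_pow, Nat.shiftRight_xor_distrib,
        Nat.shiftRight_eq_div_pow, Nat.shiftRight_eq_div_pow, Nat.div_self (by positivity)]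
    have hpos : ∀ v, 0 ≤ p.avg a v := fun v => div_nonneg (add_nonneg (ha _) (ha _)) zero_le_two
    refine (ih (by omega) _ hpos).trans ?_
    have h1 := p.sum_partner fun v => if (p.partner v).val / 2 ^ t = w.val / 2 ^ t then a v else 0
    simp only [p.partner_partner] at h1
    have h2 : ∑ v, (if v.val / 2 ^ t = w.val / 2 ^ t then p.avg a v else 0)
        = (∑ v, ((if v.val / 2 ^ t = w.val / 2 ^ t then a v else 0)
          + if (p.partner v).val / 2 ^ t = w.val / 2 ^ t then a v else 0)) / 2 := by
      rw [Finset.sum_add_distrib, ← h1, ← Finset.sum_add_distrib, Finset.sum_div]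
      refine Finset.sum_congr rfl fun v _ => ?_
      simp only [Matching.avg]
      split_ifs <;> ring
    rw [h2, pow_succ, mul_inv, mul_assoc, ← div_eq_inv_mul _ (2 : ℝ)]
    refine mul_le_mul_of_nonneg_left (div_le_div_of_nonneg_right
      (Finset.sum_le_sum fun v _ => ?_) zero_le_two) (by positivity)
    rw [hdiv]
    have e1 : ∀ v : ℕ, v / 2 ^ (t + 1) = v / 2 ^ t / 2 := fun v => by
      rw [Nat.div_div_eq_div_mul, pow_succ]
    simp only [e1]
    have e2 : ((v.val / 2 ^ t) ^^^ 1) / 2 = v.val / 2 ^ t / 2 := by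
      rw [Nat.xor_div_two]; simp
    have e3 : ((v.val / 2 ^ t) ^^^ 1) % 2 = (v.val / 2 ^ t + 1) % 2 := Nat.xor_mod_two_eq
    have hav := ha v
    by_cases c1 : v.val / 2 ^ t = w.val / 2 ^ t
    · have c2 : ¬ ((v.val / 2 ^ t) ^^^ 1) = w.val / 2 ^ t := fun h => by omega
      rw [if_pos c1, if_neg c2, if_pos (by rw [c1]), add_zero]
    · by_cases c2 : ((v.val / 2 ^ t) ^^^ 1) = w.val / 2 ^ t
      · rw [if_neg c1, if_pos c2, if_pos (by omega), zero_add]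
      · rw [if_neg c1, if_neg c2, add_zero]
        split_ifs <;> simp [hav]

/-- The squared norm is at most the maximal entry times the total mass `1`. -/
lemma sum_sq_pull_single_hypercube_le {k : ℕ} (hk : 0 < k) (t : ℕ) (ht : t ≤ k)
    (u : Fin (2 ^ k)) :
    ∑ w, pull (circuit hk (hypercube k)) t (Pi.single u 1) w ^ 2 ≤ ((2 : ℝ) ^ t)⁻¹ := by
  have h0 : ∀ v, (0 : ℝ) ≤ (Pi.single u 1 : Fin (2 ^ k) → ℝ) v := fun v => by
    rw [Pi.single_apply]; split_ifs <;> norm_num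
  have hle : ∀ w, pull (circuit hk (hypercube k)) t (Pi.single u 1) w ≤ ((2 : ℝ) ^ t)⁻¹ := by
    intro w
    refine (pull_hypercube_le hk t ht _ h0 w).trans (mul_le_of_le_one_right (by positivity) ?_)
    calc _ ≤ ∑ v, (Pi.single u 1 : Fin (2 ^ k) → ℝ) v :=
          Finset.sum_le_sum fun v _ => by split_ifs <;> simp [h0 v]
      _ = 1 := by simp [Pi.single_apply]
  calc _ ≤ ∑ w, ((2 : ℝ) ^ t)⁻¹ * pull (circuit hk (hypercube k)) t (Pi.single u 1) w := by
        refine Finset.sum_le_sum fun w _ => ?_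
        rw [sq]
        exact mul_le_mul_of_nonneg_right (hle w) (pull_nonneg _ _ _ h0 w)
    _ = ((2 : ℝ) ^ t)⁻¹ := by
        rw [← Finset.mul_sum, sum_pull]; simp [Pi.single_apply]

/-- The rows of the matrix of dimension exchange after `t` matchings. -/
lemma sum_sq_pull_single_sub_hypercube_le {k : ℕ} (hk : 0 < k) (t : ℕ) (ht : t ≤ k)
    (u v : Fin (2 ^ k)) :
    ∑ w, pull (circuit hk (hypercube k)) t (Pi.single u 1 - Pi.single v 1) w ^ 2
      ≤ 4 * ((2 : ℝ) ^ (-(t : ℝ) / 2)) ^ 2 := by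
  have h0 : ∀ u v, (0 : ℝ) ≤ (Pi.single u 1 : Fin (2 ^ k) → ℝ) v := fun u v => by
    rw [Pi.single_apply]; split_ifs <;> norm_num
  have h1 : ((2 : ℝ) ^ (-(t : ℝ) / 2)) ^ 2 = ((2 : ℝ) ^ t)⁻¹ := by
    rw [← Real.rpow_natCast _ 2, ← Real.rpow_mul zero_le_two, ← Real.rpow_natCast _ t,
      ← Real.rpow_neg zero_le_two]
    congr 1; push_cast; ring
  rw [h1, pull_sub]
  have h2 := sum_sq_pull_single_hypercube_le hk t ht u
  have h3 := sum_sq_pull_single_hypercube_le hk t ht v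
  calc _ ≤ ∑ w, (pull (circuit hk (hypercube k)) t (Pi.single u 1) w ^ 2
        + pull (circuit hk (hypercube k)) t (Pi.single v 1) w ^ 2) := by
        refine Finset.sum_le_sum fun w _ => ?_
        -- Both rows are nonnegative, so the cross term of the squared difference only helps.
        have := mul_nonneg (pull_nonneg (circuit hk (hypercube k)) t _ (h0 u) w)
          (pull_nonneg (circuit hk (hypercube k)) t _ (h0 v) w)
        rw [Pi.sub_apply]
        nlinarith
    _ ≤ _ := by
        rw [Finset.sum_add_distrib]
        have : (0 : ℝ) ≤ ((2 : ℝ) ^ t)⁻¹ := by positivity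
        linarith

/-! ### Sums with random signs -/

/-- The sign given by a coin. -/
def sgn (b : Bool) : ℤ := if b then 1 else -1

lemma sum_cons_bool (F : (Fin (n + 1) → Bool) → ℝ) :
    ∑ ε, F ε = ∑ ε : Fin n → Bool, (F (Fin.cons true ε) + F (Fin.cons false ε)) := by
  rw [← (Fin.consEquiv fun _ : Fin (n + 1) => Bool).sum_comp, Fintype.sum_prod_type,
    Fintype.sum_bool, ← Finset.sum_add_distrib]
  rfl

lemma sum_sgn_sq (β : Fin n → ℝ) :
    ∑ ε : Fin n → Bool, (∑ w, (sgn (ε w) : ℝ) * β w) ^ 2 = 2 ^ n * ∑ w, β w ^ 2 := by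
  induction n with
  | zero => simp
  | succ n ih =>
    have h := ih (fun w => β w.succ)
    have e : ∀ y : ℝ, (1 * β 0 + y) ^ 2 + (-1 * β 0 + y) ^ 2 = 2 * β 0 ^ 2 + 2 * y ^ 2 :=
      fun y => by ring
    rw [sum_cons_bool]
    simp only [Fin.sum_univ_succ, Fin.cons_zero, Fin.cons_succ, sgn, if_true, Bool.false_eq_true,
      if_false, Int.cast_one, Int.cast_neg] at h ⊢
    simp only [e, Finset.sum_add_distrib, ← Finset.mul_sum, h]
    simp
    ring

/-- Averaging over the first sign kills odd powers of `β 0`; the remaining mixed term is the second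
moment of the other signs. -/
lemma sum_sgn_pow_four_le (β : Fin n → ℝ) :
    ∑ ε : Fin n → Bool, (∑ w, (sgn (ε w) : ℝ) * β w) ^ 4 ≤ 3 * 2 ^ n * (∑ w, β w ^ 2) ^ 2 := by
  induction n with
  | zero => simp
  | succ n ih =>
    have h := ih (fun w => β w.succ)
    have h2 := sum_sgn_sq (fun w : Fin n => β w.succ)
    have e : ∀ y : ℝ, (1 * β 0 + y) ^ 4 + (-1 * β 0 + y) ^ 4
        = 2 * β 0 ^ 4 + 12 * β 0 ^ 2 * y ^ 2 + 2 * y ^ 4 := fun y => by ring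
    rw [sum_cons_bool]
    simp only [Fin.sum_univ_succ, Fin.cons_zero, Fin.cons_succ, sgn, if_true, Bool.false_eq_true,
      if_false, Int.cast_one, Int.cast_neg] at h h2 ⊢
    simp only [e, Finset.sum_add_distrib, ← Finset.mul_sum, h2]
    simp only [Finset.sum_const, Finset.card_univ, Fintype.card_pi, Fintype.card_bool,
      Finset.prod_const, Fintype.card_fin, nsmul_eq_mul, Nat.cast_pow, Nat.cast_ofNat]
    have h3 : (0 : ℝ) ≤ 2 ^ n * β 0 ^ 4 := by positivity
    rw [pow_succ (2 : ℝ) n]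
    linarith

/-- A sum with random signs is rarely much smaller than its standard deviation. -/
lemma card_small_sum_le (β : Fin n → ℝ) (hβ : 0 < ∑ w, β w ^ 2) :
    ((Finset.univ.filter fun ε : Fin n → Bool =>
      (∑ w, (sgn (ε w) : ℝ) * β w) ^ 2 < (∑ w, β w ^ 2) / 4).card : ℝ) ≤ 4 / 5 * 2 ^ n := by
  set S := ∑ w, β w ^ 2 with hS
  set Z : (Fin n → Bool) → ℝ := fun ε => ∑ w, (sgn (ε w) : ℝ) * β w with hZ
  have h2 := sum_sgn_sq β
  have h4 := sum_sgn_pow_four_le β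
  -- Markov's inequality for the square of an affine function of `Z ε ^ 2` that exceeds `S` on the
  -- event. With slope `3 / 10` the mean of that square is at most `1249 / 1600 * S ^ 2`, just below
  -- `4 / 5 * S ^ 2`.
  have h1 : ((Finset.univ.filter fun ε => Z ε ^ 2 < S / 4).card : ℝ) * S ^ 2
      ≤ ∑ ε, (S - 3 / 10 * (Z ε ^ 2 - S / 4)) ^ 2 := by
    rw [← nsmul_eq_mul]
    refine (Finset.card_nsmul_le_sum _ _ _ fun ε hε => ?_).trans
      (Finset.sum_le_sum_of_subset_of_nonneg (Finset.filter_subset _ _) fun _ _ _ => sq_nonneg _)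
    have hε' : Z ε ^ 2 < S / 4 := (Finset.mem_filter.1 hε).2
    gcongr
    linarith
  have e : ∀ ε, (S - 3 / 10 * (Z ε ^ 2 - S / 4)) ^ 2
      = 1849 / 1600 * S ^ 2 - 129 / 200 * S * Z ε ^ 2 + 9 / 100 * Z ε ^ 4 := fun ε => by ring
  simp only [e, Finset.sum_add_distrib, Finset.sum_sub_distrib, ← Finset.mul_sum] at h1
  rw [show ∑ ε, Z ε ^ 2 = 2 ^ n * S from h2] at h1
  have h4' : ∑ ε, Z ε ^ 4 ≤ 3 * 2 ^ n * S ^ 2 := h4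
  simp only [Finset.sum_const, Finset.card_univ, Fintype.card_pi, Fintype.card_bool,
    Finset.prod_const, Fintype.card_fin, nsmul_eq_mul] at h1
  push_cast at h1
  have hS2 : 0 < S ^ 2 := by positivity
  refine le_of_mul_le_mul_right (h1.trans ?_) hS2
  have h5 : (0 : ℝ) ≤ 2 ^ n * S ^ 2 := by positivity
  nlinarith

/-- Signs of integers for which the sum is divisible by `N`: at most half of them, if one summand
is nonzero and smaller than `N / 2`. -/
lemma card_dvd_sum_le (d : Fin n → ℤ) (N : ℤ) (w₀ : Fin n) (h0 : d w₀ ≠ 0)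
    (hN : 2 * |d w₀| < N) :
    ((Finset.univ.filter fun ε : Fin n → Bool => N ∣ ∑ w, sgn (ε w) * d w).card : ℝ)
      ≤ 4 / 5 * 2 ^ n := by
  set S := Finset.univ.filter fun ε : Fin n → Bool => N ∣ ∑ w, sgn (ε w) * d w with hS
  -- Flipping the sign at `w₀` changes the sum by `2 * |d w₀|`, which is nonzero and smaller than
  -- `N`. So a sign vector and its flip cannot both give a multiple of `N`.
  set φ : (Fin n → Bool) → Fin n → Bool := fun ε => Function.update ε w₀ (!ε w₀) with hφ
  have hinj : Function.Injective φ := by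
    refine Function.Involutive.injective fun ε => ?_
    simp [hφ]
  have hdiff : ∀ ε, ∑ w, sgn (ε w) * d w - ∑ w, sgn (φ ε w) * d w = 2 * (sgn (ε w₀) * d w₀) := by
    intro ε
    rw [← Finset.sum_sub_distrib, Finset.sum_eq_single w₀]
    · simp only [hφ, Function.update_self]
      cases ε w₀ <;> simp [sgn] <;> ring
    · intro w _ hw
      simp [hφ, Function.update_of_ne hw]
    · simp
  have hdisj : Disjoint S (S.image φ) := by
    rw [Finset.disjoint_left]
    intro ε hε hε'
    obtain ⟨ε', h1, rfl⟩ := Finset.mem_image.1 hε'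
    have h2 := dvd_sub (Finset.mem_filter.1 h1).2 (Finset.mem_filter.1 hε).2
    rw [hdiff] at h2
    have h3 : |2 * (sgn (ε' w₀) * d w₀)| = 2 * |d w₀| := by
      rw [abs_mul, abs_mul]
      cases ε' w₀ <;> simp [sgn]
    have h4 := Int.eq_zero_of_abs_lt_dvd h2 (by rw [h3]; exact hN)
    rw [h4] at h3
    simp at h3
    exact h0 h3
  have hcard := Finset.card_le_univ (S ∪ S.image φ)
  rw [Finset.card_union_of_disjoint hdisj, Finset.card_image_of_injective _ hinj] at hcard
  simp only [Fintype.card_pi, Fintype.card_bool, Finset.prod_const, Finset.card_univ,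
    Fintype.card_fin] at hcard
  have h5 : (S.card : ℝ) + S.card ≤ 2 ^ n := by exact_mod_cast hcard
  have h6 : (0 : ℝ) < 2 ^ n := by positivity
  linarith

/-! ### Symmetrization -/

/-- The pairs with the coordinates exchanged where the coin shows `false`. -/
def swapPairs (ε : Fin n → Bool) (z : Fin n → ℕ × ℕ) : Fin n → ℕ × ℕ :=
  fun w => if ε w then z w else (z w).swap

section Symmetrization

variable (D : Measure ℕ) [IsProbabilityMeasure D]

lemma measurePreserving_swapPairs (ε : Fin n → Bool) :
    MeasurePreserving (swapPairs ε) (Measure.pi fun _ : Fin n => D.prod D)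
      (Measure.pi fun _ : Fin n => D.prod D) := by
  refine measurePreserving_pi (f := fun w (y : ℕ × ℕ) => if ε w then y else y.swap) _ _
    fun w => ?_
  cases ε w
  · simpa using Measure.measurePreserving_swap (μ := D) (ν := D)
  · simp only [if_true]
    exact MeasurePreserving.id (D.prod D)

/-- A vector of independent pairs is a pair of independent vectors. -/
lemma pi_prod_real (B : Set (Fin n → ℕ)) :
    (Measure.pi fun _ : Fin n => D.prod D).real
      {z | (fun w => (z w).1) ∈ B ∧ (fun w => (z w).2) ∈ B}
      = (Measure.pi fun _ : Fin n => D).real B ^ 2 := by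
  have h := (measurePreserving_arrowProdEquivProdArrow ℕ ℕ (Fin n) (fun _ => D)
    (fun _ => D)).measure_preimage (s := B ×ˢ B) MeasurableSet.of_discrete.nullMeasurableSet
  rw [Measure.prod_prod] at h
  rw [measureReal_def, measureReal_def, sq, ← ENNReal.toReal_mul, ← h]
  rfl

open Classical in
/-- If exchanging the members of independent pairs rarely leaves both copies in `B`, then `B` has
small probability. -/
lemma real_sq_le_of_swap (B : Set (Fin n → ℕ)) (G : Set (Fin n → ℕ × ℕ)) (q : ℝ) (hq : 0 ≤ q)
    (h : ∀ z ∈ G, ((Finset.univ.filter fun ε : Fin n → Bool =>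
      (fun w => (swapPairs ε z w).1) ∈ B ∧ (fun w => (swapPairs ε z w).2) ∈ B).card : ℝ)
        ≤ q * 2 ^ n) :
    (Measure.pi fun _ : Fin n => D).real B ^ 2
      ≤ q + (Measure.pi fun _ : Fin n => D.prod D).real Gᶜ := by
  set P := Measure.pi fun _ : Fin n => D.prod D with hP
  set E : Set (Fin n → ℕ × ℕ) := {z | (fun w => (z w).1) ∈ B ∧ (fun w => (z w).2) ∈ B} with hE
  have hint : ∀ S : Set (Fin n → ℕ × ℕ), Integrable (S.indicator fun _ => (1 : ℝ)) P := fun S =>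
    (integrable_const _).indicator MeasurableSet.of_discrete
  have hval : ∀ S : Set (Fin n → ℕ × ℕ), ∫ z, S.indicator (fun _ => (1 : ℝ)) z ∂P = P.real S :=
    fun S => by rw [integral_indicator_const _ MeasurableSet.of_discrete]; simp
  have hsum : ∀ z, ∑ ε, (swapPairs ε ⁻¹' E).indicator (fun _ => (1 : ℝ)) z
      = ((Finset.univ.filter fun ε : Fin n → Bool =>
      (fun w => (swapPairs ε z w).1) ∈ B ∧ (fun w => (swapPairs ε z w).2) ∈ B).card : ℝ) := by
    intro z
    rw [Finset.card_filter, Nat.cast_sum]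
    refine Finset.sum_congr rfl fun ε _ => ?_
    simp only [Set.indicator_apply, Set.mem_preimage, hE, Set.mem_ofPred_eq]
    split_ifs <;> simp
  -- The law of `z` is invariant under every exchange, so the probability that both copies lie in
  -- `B` can be averaged over `ε` for each fixed `z`; off `G` the trivial count is used.
  have h1 : ∀ z, ∑ ε, (swapPairs ε ⁻¹' E).indicator (fun _ => (1 : ℝ)) z
      ≤ q * 2 ^ n + 2 ^ n * Gᶜ.indicator (fun _ => (1 : ℝ)) z := by
    intro z
    rw [hsum]
    by_cases hz : z ∈ G
    · rw [Set.indicator_of_notMem (by simpa using hz), mul_zero, add_zero]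
      exact h z hz
    · rw [Set.indicator_of_mem (by simpa using hz), mul_one]
      have h2 := Finset.card_le_univ (Finset.univ.filter fun ε : Fin n → Bool =>
        (fun w => (swapPairs ε z w).1) ∈ B ∧ (fun w => (swapPairs ε z w).2) ∈ B)
      simp only [Fintype.card_pi, Fintype.card_bool, Finset.prod_const, Finset.card_univ,
        Fintype.card_fin] at h2
      have h3 : ((Finset.univ.filter fun ε : Fin n → Bool =>
        (fun w => (swapPairs ε z w).1) ∈ B ∧ (fun w => (swapPairs ε z w).2) ∈ B).card : ℝ)
          ≤ 2 ^ n := by exact_mod_cast h2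
      have : 0 ≤ q * 2 ^ n := by positivity
      linarith
  have h2 := integral_mono (μ := P) (integrable_finsetSum _ fun ε _ => hint (swapPairs ε ⁻¹' E))
    ((integrable_const (q * 2 ^ n)).add ((hint Gᶜ).const_mul (2 ^ n))) h1
  have h3 : ∫ z, ∑ ε, (swapPairs ε ⁻¹' E).indicator (fun _ => (1 : ℝ)) z ∂P
      = 2 ^ n * P.real E := by
    rw [integral_finsetSum _ fun ε _ => hint (swapPairs ε ⁻¹' E)]
    have : ∀ ε : Fin n → Bool, P.real (swapPairs ε ⁻¹' E) = P.real E := fun ε => by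
      rw [measureReal_def, measureReal_def, (measurePreserving_swapPairs D ε).measure_preimage
        MeasurableSet.of_discrete.nullMeasurableSet]
    simp only [hval, this]
    simp
  have h4 : ∫ z, (q * 2 ^ n + 2 ^ n * Gᶜ.indicator (fun _ => (1 : ℝ)) z) ∂P
      = 2 ^ n * (q + P.real Gᶜ) := by
    rw [integral_add (integrable_const _) ((hint Gᶜ).const_mul (2 ^ n)),
      integral_const_mul (2 ^ n), hval]
    simp
    ring
  rw [← pi_prod_real]
  have h5 : 2 ^ n * P.real E ≤ 2 ^ n * (q + P.real Gᶜ) := by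
    rw [← h3, ← h4]; exact h2
  exact le_of_mul_le_mul_left h5 (by positivity)

/-- The number of coordinates in `S`. -/
noncomputable def numIn (S : Set (ℕ × ℕ)) (z : Fin n → ℕ × ℕ) : ℝ :=
  ∑ w, S.indicator (fun _ => (1 : ℝ)) (z w)

/-- The number of coordinates in a set is rarely much smaller than its expectation. -/
lemma real_numIn_lt_le (S : Set (ℕ × ℕ)) (p : ℝ) (hp : p ≤ (D.prod D).real S) :
    (Measure.pi fun _ : Fin n => D.prod D).real {z | p * n / 4 ≤ numIn S z}ᶜ
      ≤ Real.exp (-(p * n / 4)) := by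
  set P := Measure.pi fun _ : Fin n => D.prod D with hP
  -- Chernoff's bound at exponent `-1`: each factor has mean at most `exp (-(p / 2))`, so a count
  -- below half of that total exponent is exponentially unlikely.
  set f : ℕ × ℕ → ℝ := fun y => Real.exp (-S.indicator (fun _ => (1 : ℝ)) y) with hf
  have hfeq : f = fun y => 1 - (1 - Real.exp (-1)) * S.indicator (fun _ => (1 : ℝ)) y := by
    funext y
    by_cases hy : y ∈ S <;> simp [hf, hy]
  have hI : Integrable (S.indicator fun _ => (1 : ℝ)) (D.prod D) :=
    (integrable_const _).indicator MeasurableSet.of_discrete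
  have hfint : Integrable f (D.prod D) := by
    rw [hfeq]; exact (integrable_const _).sub (hI.const_mul _)
  have he : Real.exp (-1) ≤ 1 / 2 := by
    rw [Real.exp_neg, ← one_div]
    exact one_div_le_one_div_of_le two_pos (by linarith [Real.add_one_le_exp 1])
  have hf1 : ∫ y, f y ∂(D.prod D) ≤ Real.exp (-(p / 2)) := by
    have h1 : ∫ y, f y ∂(D.prod D) = 1 - (1 - Real.exp (-1)) * (D.prod D).real S := by
      rw [hfeq, integral_sub (integrable_const _) (hI.const_mul _), integral_const_mul,
        integral_indicator_const _ MeasurableSet.of_discrete]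
      simp
    rw [h1]
    have h2 : (0 : ℝ) ≤ (D.prod D).real S := measureReal_nonneg
    have h3 := Real.add_one_le_exp (-(p / 2))
    nlinarith
  have hf0 : 0 ≤ ∫ y, f y ∂(D.prod D) := integral_nonneg fun y => (Real.exp_pos _).le
  have hprod : Integrable (fun z : Fin n → ℕ × ℕ => ∏ w, f (z w)) P :=
    Integrable.fintype_prod (f := fun _ => f) fun _ => hfint
  have hpt : ∀ z : Fin n → ℕ × ℕ, ({z | p * n / 4 ≤ numIn S z}ᶜ).indicator (fun _ => (1 : ℝ)) z
      ≤ Real.exp (p * n / 4) * ∏ w, f (z w) := by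
    intro z
    have h1 : ∏ w, f (z w) = Real.exp (-numIn S z) := by
      rw [numIn, ← Finset.sum_neg_distrib, Real.exp_sum]
    rw [h1, ← Real.exp_add]
    by_cases hz : p * n / 4 ≤ numIn S z
    · rw [Set.indicator_of_notMem (by simpa using hz)]
      exact (Real.exp_pos _).le
    · rw [Set.indicator_of_mem (by simpa using hz), Real.one_le_exp_iff]
      linarith
  have h2 := integral_mono (μ := P) ((integrable_const (1 : ℝ)).indicator
    (MeasurableSet.of_discrete (s := {z | p * n / 4 ≤ numIn S z}ᶜ)))
    (hprod.const_mul (Real.exp (p * n / 4))) hpt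
  rw [integral_indicator_const _ MeasurableSet.of_discrete, integral_const_mul,
    integral_fintype_prod_eq_pow] at h2
  simp only [smul_eq_mul, mul_one, Fintype.card_fin] at h2
  refine h2.trans ?_
  calc _ ≤ Real.exp (p * n / 4) * Real.exp (-(p / 2)) ^ n := by gcongr
    _ = _ := by rw [← Real.exp_nat_mul, ← Real.exp_add]; congr 1; ring

end Symmetrization

/-! ### The lower bounds -/

/-- The deviation of the continuous load of node `u` from the average load. -/
noncomputable def dev (m : ℕ → Matching n) (s : ℕ) (x : Fin n → ℝ) (u : Fin n) : ℝ :=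
  push m s x u - (∑ w, x w) / n

/-- The coefficients of `dev`. -/
noncomputable def devCoeff (m : ℕ → Matching n) (s : ℕ) (u w : Fin n) : ℝ :=
  push m s (Pi.single w 1) u - 1 / n

lemma dev_eq_sum (m : ℕ → Matching n) (s : ℕ) (x : Fin n → ℝ) (u : Fin n) :
    dev m s x u = ∑ w, x w * devCoeff m s u w := by
  have h : push m s x = ∑ w, x w • push m s (Pi.single w 1) := by
    have := (pushLin m s).pi_apply_eq_sum_univ x
    simp only [pushLin, LinearMap.coe_mk, AddHom.coe_mk] at this
    rw [this]
    refine Finset.sum_congr rfl fun w _ => ?_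
    congr 2
    funext v
    simp [Pi.single_apply, eq_comm]
  rw [dev, h]
  simp only [Finset.sum_apply, Pi.smul_apply, smul_eq_mul, devCoeff, mul_sub,
    Finset.sum_sub_distrib, Finset.sum_div, mul_one_div]

/-- Centring costs exactly `1 / n`, at most half of the `2⁻ˢ` that repeated halving leaves. The sum
runs over the receiving nodes `u`; fixing `u` instead would give no such bound for a general
circuit. -/
lemma sum_sq_devCoeff_ge (m : ℕ → Matching n) (s : ℕ) (hn : 2 * 2 ^ s ≤ n) (w : Fin n) :
    ((2 : ℝ) ^ s)⁻¹ / 2 ≤ ∑ u, devCoeff m s u w ^ 2 := by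
  have hn' : (2 : ℝ) * 2 ^ s ≤ n := by exact_mod_cast hn
  have hn0 : (0 : ℝ) < n := lt_of_lt_of_le (by positivity) hn'
  have e : ∀ u, devCoeff m s u w ^ 2
      = push m s (Pi.single w 1) u ^ 2 - 2 / n * push m s (Pi.single w 1) u + 1 / (n : ℝ) ^ 2 :=
    fun u => by rw [devCoeff]; ring
  have h1 : ∑ u, devCoeff m s u w ^ 2 = ∑ u, push m s (Pi.single w 1) u ^ 2 - 1 / n := by
    simp only [e, Finset.sum_add_distrib, Finset.sum_sub_distrib, ← Finset.mul_sum, sum_push]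
    simp [Pi.single_apply]
    field_simp
    ring
  have h2 := two_pow_neg_le_sum_sq_push m s w
  have h3 : 1 / (n : ℝ) ≤ ((2 : ℝ) ^ s)⁻¹ / 2 := by
    rw [← one_div, div_div]
    exact one_div_le_one_div_of_le (by positivity) (by linarith)
  rw [h1]
  linarith

/-- The initial loads for which the continuous loads are all close to the average. -/
def flatLoads (m : ℕ → Matching n) (s : ℕ) (r : ℝ) : Set (Fin n → ℕ) :=
  {x | ∀ u, |dev m s (fun w => (x w : ℝ)) u| < r}

/-- The initial loads whose total number of tokens is a multiple of the number of nodes. -/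
def divisibleLoads (n : ℕ) : Set (Fin n → ℕ) := {x | (n : ℤ) ∣ ∑ w, (x w : ℤ)}

lemma swapPairs_sub (ε : Fin n → Bool) (z : Fin n → ℕ × ℕ) (w : Fin n) :
    ((swapPairs ε z w).1 : ℤ) - (swapPairs ε z w).2 = sgn (ε w) * (((z w).1 : ℤ) - (z w).2) := by
  simp only [swapPairs, sgn]
  cases ε w <;> simp

lemma swapPairs_sub_real (ε : Fin n → Bool) (z : Fin n → ℕ × ℕ) (w : Fin n) :
    ((swapPairs ε z w).1 : ℝ) - (swapPairs ε z w).2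
      = (sgn (ε w) : ℝ) * (((z w).1 : ℝ) - (z w).2) := by
  exact_mod_cast swapPairs_sub ε z w

section Lower

open Classical in
-- Summing over origins `w` and receivers `u`, the good pairs contribute at least `n * (16 * r ^
-- 2)`, so some receiver `u` has sign variance at least `16 * r ^ 2`. If both copies are flat, their
-- deviations at `u` differ by less than `2 * r`, half the standard deviation of that sign sum.
lemma card_flatLoads_le (D : Measure ℕ) (m : ℕ → Matching n) (s : ℕ) (hn : 2 * 2 ^ s ≤ n) (C p r : ℝ)
    (hσ : 0 < sd D) (hr : 0 < r)
    (hr2 : r ^ 2 = p / 128 * (((2 : ℝ) ^ s)⁻¹ * sd D ^ 2)) (z : Fin n → ℕ × ℕ)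
    (hz : p * n / 4 ≤ numIn (spread D C) z) :
    ((Finset.univ.filter fun ε : Fin n → Bool => (fun w => (swapPairs ε z w).1) ∈ flatLoads m s r ∧
      (fun w => (swapPairs ε z w).2) ∈ flatLoads m s r).card : ℝ) ≤ 4 / 5 * 2 ^ n := by
  have hn0 : 0 < n := lt_of_lt_of_le (by positivity) hn
  have hn' : (0 : ℝ) < n := by exact_mod_cast hn0
  have : Nonempty (Fin n) := ⟨⟨0, hn0⟩⟩
  set d : Fin n → ℝ := fun w => ((z w).1 : ℝ) - (z w).2 with hd
  have hsum : (n : ℝ) * (16 * r ^ 2) ≤ ∑ u, ∑ w, (d w * devCoeff m s u w) ^ 2 := by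
    rw [Finset.sum_comm]
    calc (n : ℝ) * (16 * r ^ 2) = p * n / 4 * (sd D ^ 2 * (((2 : ℝ) ^ s)⁻¹ / 2)) := by
          rw [hr2]; ring
      _ ≤ numIn (spread D C) z * (sd D ^ 2 * (((2 : ℝ) ^ s)⁻¹ / 2)) := by gcongr
      _ = ∑ w, (spread D C).indicator (fun _ => (1 : ℝ)) (z w)
            * (sd D ^ 2 * (((2 : ℝ) ^ s)⁻¹ / 2)) := by rw [numIn, Finset.sum_mul]
      _ ≤ ∑ w, ∑ u, (d w * devCoeff m s u w) ^ 2 := by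
          refine Finset.sum_le_sum fun w _ => ?_
          simp only [mul_pow, ← Finset.mul_sum]
          by_cases hw : z w ∈ spread D C
          · rw [Set.indicator_of_mem hw, one_mul]
            have h1 : sd D ^ 2 ≤ d w ^ 2 := by
              rw [← sq_abs (d w)]
              have := hw.1
              gcongr
            have h2 := sum_sq_devCoeff_ge m s hn w
            gcongr
          · rw [Set.indicator_of_notMem hw, zero_mul]
            exact mul_nonneg (sq_nonneg _) (Finset.sum_nonneg fun _ _ => sq_nonneg _)
  obtain ⟨u, -, hu⟩ := Finset.exists_le_of_sum_le (s := (Finset.univ : Finset (Fin n)))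
    (f := fun _ => 16 * r ^ 2) (g := fun u => ∑ w, (d w * devCoeff m s u w) ^ 2)
    Finset.univ_nonempty (by simpa using hsum)
  have hpos : 0 < ∑ w, (d w * devCoeff m s u w) ^ 2 := lt_of_lt_of_le (by positivity) hu
  refine le_trans ?_ (card_small_sum_le (fun w => d w * devCoeff m s u w) hpos)
  norm_cast
  refine Finset.card_le_card fun ε hε => ?_
  obtain ⟨h1, h2⟩ := (Finset.mem_filter.1 hε).2
  refine Finset.mem_filter.2 ⟨Finset.mem_univ _, ?_⟩
  have h3 := h1 u
  have h4 := h2 u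
  have h5 : ∑ w, (sgn (ε w) : ℝ) * (d w * devCoeff m s u w)
      = dev m s (fun w => ((swapPairs ε z w).1 : ℝ)) u
        - dev m s (fun w => ((swapPairs ε z w).2 : ℝ)) u := by
    rw [dev_eq_sum, dev_eq_sum, ← Finset.sum_sub_distrib]
    refine Finset.sum_congr rfl fun w _ => ?_
    rw [← sub_mul, swapPairs_sub_real, mul_assoc]
  rw [h5]
  have h6 : |dev m s (fun w => ((swapPairs ε z w).1 : ℝ)) u
        - dev m s (fun w => ((swapPairs ε z w).2 : ℝ)) u| < 2 * r := by
    refine (abs_sub _ _).trans_lt ?_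
    linarith
  rw [← sq_abs]
  calc _ < (2 * r) ^ 2 := by gcongr
    _ ≤ _ := by linarith

open Classical in
-- If both totals are multiples of `n`, so is the signed sum of the differences. One pair in `spread
-- D C` supplies a nonzero summand smaller than `n / 2`.
lemma card_divisibleLoads_le (D : Measure ℕ) (C : ℝ) (hσ : 0 < sd D) (hC : 2 * (C * sd D) < n)
    (z : Fin n → ℕ × ℕ) (hz : 0 < numIn (spread D C) z) :
    ((Finset.univ.filter fun ε : Fin n → Bool =>
      (fun w => (swapPairs ε z w).1) ∈ divisibleLoads n ∧
      (fun w => (swapPairs ε z w).2) ∈ divisibleLoads n).card : ℝ) ≤ 4 / 5 * 2 ^ n := by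
  obtain ⟨w₀, -, hw₀⟩ := Finset.exists_ne_zero_of_sum_ne_zero hz.ne'
  have hw : z w₀ ∈ spread D C := by
    by_contra h
    exact hw₀ (Set.indicator_of_notMem h _)
  obtain ⟨h1, h2⟩ := hw
  have hcast : |((z w₀).1 : ℝ) - (z w₀).2| = ((|((z w₀).1 : ℤ) - (z w₀).2| : ℤ) : ℝ) := by
    push_cast; rfl
  rw [hcast] at h1 h2
  refine le_trans ?_ (card_dvd_sum_le (fun w => ((z w).1 : ℤ) - (z w).2) n w₀ ?_ ?_)
  · refine Nat.cast_le.2 (Finset.card_le_card fun ε hε => ?_)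
    obtain ⟨h1, h2⟩ := (Finset.mem_filter.1 hε).2
    refine Finset.mem_filter.2 ⟨Finset.mem_univ _, ?_⟩
    have h3 := dvd_sub (show (n : ℤ) ∣ _ from h1) (show (n : ℤ) ∣ _ from h2)
    rw [← Finset.sum_sub_distrib] at h3
    simpa only [swapPairs_sub] using h3
  · intro h
    rw [h] at h1
    simp at h1
    linarith
  · have : (2 : ℝ) * ((|((z w₀).1 : ℤ) - (z w₀).2| : ℤ) : ℝ) < n := by linarith
    exact_mod_cast this

variable (D : Measure ℕ) [IsProbabilityMeasure D]

/-- The probability of a set of initial loads is at most `9/10` if, for every vector of pairs with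
many coordinates in `spread`, a fifth of the exchanges move one of the two copies out of it. -/
lemma real_le_of_card_le {C p : ℝ} (hp : 0 < p) (hD : p ≤ (D.prod D).real (spread D C))
    (hn : 400 / p ≤ n) (B : Set (Fin n → ℕ))
    (h : by
      classical exact ∀ z : Fin n → ℕ × ℕ, p * n / 4 ≤ numIn (spread D C) z →
      ((Finset.univ.filter fun ε : Fin n → Bool =>
      (fun w => (swapPairs ε z w).1) ∈ B ∧ (fun w => (swapPairs ε z w).2) ∈ B).card : ℝ)
        ≤ 4 / 5 * 2 ^ n) :
    (Measure.pi fun _ : Fin n => D).real B ≤ 9 / 10 := by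
  have h1 := real_sq_le_of_swap D B {z | p * n / 4 ≤ numIn (spread D C) z} (4 / 5) (by norm_num) h
  have h2 := real_numIn_lt_le (n := n) D (spread D C) p hD
  have h3 : 100 ≤ p * n / 4 := by
    rw [div_le_iff₀ hp] at hn
    linarith
  have h4 : Real.exp (-(p * n / 4)) ≤ 1 / 100 := by
    rw [Real.exp_neg, ← one_div]
    exact one_div_le_one_div_of_le (by norm_num) (by linarith [Real.add_one_le_exp (p * n / 4)])
  -- The numbers fit: `4 / 5 + 1 / 100 = (9 / 10) ^ 2`.
  have h5 : (Measure.pi fun _ : Fin n => D).real B ^ 2 ≤ (9 / 10) ^ 2 := by linarith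
  exact le_of_sq_le_sq h5 (by norm_num)

lemma loadLaw_real_le (m : ℕ → Matching n) (s : ℕ) (S : Set (Fin n → ℤ)) (B : Set (Fin n → ℕ))
    (δ : ℝ) (hδ : 0 ≤ δ)
    (h : ∀ x₀ ∉ B, (run m (fun u => (x₀ u : ℤ)) s).toMeasure S ≤ ENNReal.ofReal δ) :
    (loadLaw D m s).real S ≤ (Measure.pi fun _ : Fin n => D).real B + δ := by
  have h1 : loadLaw D m s S ≤ (Measure.pi fun _ : Fin n => D) B + ENNReal.ofReal δ := by
    rw [loadLaw_apply]
    calc _ ≤ ∫⁻ x₀, (B.indicator (fun _ => 1) x₀ + ENNReal.ofReal δ)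
          ∂(Measure.pi fun _ : Fin n => D) := by
          refine lintegral_mono fun x₀ => ?_
          by_cases hx : x₀ ∈ B
          · simp only [Set.indicator_of_mem hx]
            exact prob_le_one.trans le_self_add
          · simp only [Set.indicator_of_notMem hx, zero_add]
            exact h x₀ hx
      _ = _ := by
          rw [lintegral_add_right _ measurable_const,
            lintegral_indicator_const MeasurableSet.of_discrete]
          simp
  rw [measureReal_def, measureReal_def, ← ENNReal.toReal_ofReal hδ,
    ← ENNReal.toReal_add (measure_ne_top _ _) ENNReal.ofReal_ne_top]
  exact ENNReal.toReal_mono (ENNReal.add_ne_top.2 ⟨measure_ne_top _ _, ENNReal.ofReal_ne_top⟩) h1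

lemma abs_sub_avg_le_disc (hn : 0 < n) (x : Fin n → ℤ) (u : Fin n) :
    |(x u : ℝ) - (∑ w, (x w : ℝ)) / n| ≤ disc x := by
  have hn' : (0 : ℝ) < n := by exact_mod_cast hn
  have e : (x u : ℝ) - (∑ w, (x w : ℝ)) / n = (∑ w, ((x u : ℝ) - x w)) / n := by
    rw [Finset.sum_sub_distrib]
    simp
    field_simp
  have h : ∀ w, |(x u : ℝ) - x w| ≤ disc x := by
    intro w
    rw [abs_le]
    have h1 : (x u : ℝ) - x w ≤ disc x := by exact_mod_cast sub_le_disc x u w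
    have h2 : (x w : ℝ) - x u ≤ disc x := by exact_mod_cast sub_le_disc x w u
    constructor <;> linarith
  rw [e, abs_div, abs_of_pos hn', div_le_iff₀ hn']
  calc _ ≤ ∑ w, |(x u : ℝ) - x w| := Finset.abs_sum_le_sum_abs _ _
    _ ≤ ∑ w : Fin n, (disc x : ℝ) := Finset.sum_le_sum fun w _ => h w
    _ = _ := by simp [mul_comm]

/-- The vector testing the deviation of the load of `u` from the average. -/
noncomputable def devTest (u : Fin n) : Fin n → ℝ := fun w => (Pi.single u 1 : Fin n → ℝ) w - 1 / n

lemma pairing_devTest (u : Fin n) (x : Fin n → ℤ) :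
    pairing (devTest u) x = (x u : ℝ) - (∑ w, (x w : ℝ)) / n := by
  simp only [pairing, devTest, sub_mul, Finset.sum_sub_distrib, ← Finset.mul_sum]
  simp [Pi.single_apply]
  ring

lemma pairing_pull_devTest (m : ℕ → Matching n) (s : ℕ) (u : Fin n) (x : Fin n → ℕ) :
    pairing (pull m s (devTest u)) (fun w => (x w : ℤ)) = dev m s (fun w => (x w : ℝ)) u := by
  simp only [pairing, Int.cast_natCast]
  rw [sum_pull_mul]
  simp only [devTest, sub_mul, Finset.sum_sub_distrib, ← Finset.mul_sum, sum_push, dev]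
  simp [Pi.single_apply]
  ring

lemma sum_sq_devTest_le (hn : 0 < n) (u : Fin n) : ∑ w, devTest u w ^ 2 ≤ 1 := by
  have hn' : (0 : ℝ) < n := by exact_mod_cast hn
  have e : ∀ w, devTest u w ^ 2 = (1 - 2 / n) * (Pi.single u 1 : Fin n → ℝ) w + 1 / (n : ℝ) ^ 2 := by
    intro w
    simp only [devTest, Pi.single_apply]
    split_ifs <;> ring
  simp only [e, Finset.sum_add_distrib, ← Finset.mul_sum]
  simp [Pi.single_apply]
  have h : (n : ℝ) * ((n : ℝ) ^ 2)⁻¹ = 1 / n := by field_simp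
  rw [h]
  have : 2 / (n : ℝ) = 2 * (1 / n) := by ring
  rw [this]
  have : 0 < 1 / (n : ℝ) := by positivity
  linarith

/-- Rounding rarely hides a large deviation of the continuous loads. -/
lemma run_disc_lt_le (hn : 0 < n) (m : ℕ → Matching n) (s : ℕ) (r : ℝ) (hr : 0 ≤ r)
    (x₀ : Fin n → ℕ) (hx : x₀ ∉ flatLoads m s r) :
    (run m (fun u => (x₀ u : ℤ)) s).toMeasure {x | (disc x : ℝ) < r / 2}
      ≤ ENNReal.ofReal (Real.exp (-(r ^ 2 / 4))) := by
  simp only [flatLoads, Set.mem_ofPred_eq, not_forall, not_lt] at hx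
  obtain ⟨u, hu⟩ := hx
  obtain ⟨τ, hτ, hτu⟩ : ∃ τ : ℝ, |τ| = 1 ∧ r ≤ τ * dev m s (fun w => (x₀ w : ℝ)) u := by
    rcases abs_cases (dev m s (fun w => (x₀ w : ℝ)) u) with ⟨h, -⟩ | ⟨h, -⟩
    · exact ⟨1, by norm_num, by linarith⟩
    · exact ⟨-1, by norm_num, by linarith⟩
  have hτ2 : τ ^ 2 = 1 := by rw [← sq_abs, hτ, one_pow]
  have hpair : ∀ (c : ℝ) (a : Fin n → ℝ) (x : Fin n → ℤ),
      pairing (c • a) x = c * pairing a x := fun c a x => by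
    simp only [pairing, Pi.smul_apply, smul_eq_mul, mul_assoc, Finset.mul_sum]
  -- Chernoff's bound with parameter `r`: the threshold costs `r ^ 2 / 2`, the deviation gains `r ^
  -- 2`, and rounding costs at most `r ^ 2 / 4`.
  refine (toMeasure_le_expect _ _ (fun y =>
    ENNReal.ofReal (Real.exp (pairing ((-(r * τ)) • devTest u) y))
      * ENNReal.ofReal (Real.exp (r ^ 2 / 2))) ?_).trans ?_
  · intro x hx
    rw [← ENNReal.ofReal_mul (Real.exp_pos _).le, ← Real.exp_add, ← ENNReal.ofReal_one]
    apply ENNReal.ofReal_le_ofReal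
    rw [Real.one_le_exp_iff, hpair, pairing_devTest]
    have h1 := abs_sub_avg_le_disc hn x u
    have h2 : (disc x : ℝ) < r / 2 := hx
    have h3 : τ * ((x u : ℝ) - (∑ w, (x w : ℝ)) / n) ≤ r / 2 := by
      refine (le_abs_self _).trans ?_
      rw [abs_mul, hτ, one_mul]
      linarith
    nlinarith
  · rw [expect_mul_const]
    refine (mul_le_mul_left (expect_run_le m _ s _) _).trans ?_
    rw [← ENNReal.ofReal_mul (Real.exp_pos _).le, ← Real.exp_add,
      ← ENNReal.ofReal_mul (Real.exp_pos _).le, ← Real.exp_add]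
    apply ENNReal.ofReal_le_ofReal
    apply Real.exp_le_exp.2
    rw [pull_smul, hpair, pairing_pull_devTest]
    simp only [Pi.smul_apply, smul_eq_mul, mul_pow, ← Finset.mul_sum, neg_sq, hτ2, mul_one]
    have h1 := sum_sq_devTest_le hn u
    have h2 : r ^ 2 * ∑ w, devTest u w ^ 2 ≤ r ^ 2 * 1 := by gcongr
    have h3 : r * r ≤ r * (τ * dev m s (fun w => (x₀ w : ℝ)) u) := by gcongr
    nlinarith

/-- Discrepancy below `1` means equal integer loads, so the conserved total is a multiple of `n`. -/
lemma run_disc_lt_one_eq_zero (hn : 0 < n) (m : ℕ → Matching n) (s : ℕ) (x₀ : Fin n → ℕ)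
    (hx : x₀ ∉ divisibleLoads n) :
    (run m (fun u => (x₀ u : ℤ)) s).toMeasure {x | (disc x : ℝ) < 1} = 0 := by
  rw [PMF.toMeasure_apply_eq_zero_iff _ MeasurableSet.of_discrete, Set.disjoint_left]
  intro x hsupp hdisc
  have h1 := sum_eq_of_mem_support_run m _ s x hsupp
  have h2 : disc x < 1 := by exact_mod_cast (show (disc x : ℝ) < 1 from hdisc)
  have h3 : ∀ u, x u = x ⟨0, hn⟩ := fun u => by
    have e1 := sub_le_disc x u ⟨0, hn⟩
    have e2 := sub_le_disc x ⟨0, hn⟩ u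
    omega
  apply hx
  rw [divisibleLoads, Set.mem_ofPred_eq, ← h1, Finset.sum_congr rfl fun u _ => h3 u]
  simp

end Lower

/-- The discrepancy is bounded below by the deviation in the continuous process. -/
theorem exists_disc_lower (A κ : ℝ) (hκ : 0 < κ) : ∃ (c : ℝ) (n₀ : ℕ), 0 < c ∧
    ∀ (D : Measure ℕ) [IsProbabilityMeasure D], ExpConcentrated D A κ →
      ∀ (n : ℕ) (m : ℕ → Matching n) (s : ℕ), n₀ ≤ n → 2 * 2 ^ s ≤ n → 2 ≤ sd D →
        (1 / 16 : ℝ) ≤ (loadLaw D m s).real {x | c * ((2 : ℝ) ^ (-(s : ℝ) / 2) * sd D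
          / √(Real.log (sd D))) ≤ (disc x : ℝ)} := by
  obtain ⟨C, p, hC, hp, hspread⟩ := exists_spread A κ hκ
  set c₁ : ℝ := √(p / 128) with hc₁
  have hc₁pos : 0 < c₁ := Real.sqrt_pos.2 (by positivity)
  have hc₁sq : c₁ ^ 2 = p / 128 := Real.sq_sqrt (by positivity)
  refine ⟨c₁ / 12, ⌈400 / p + 72 * C ^ 2 / c₁ ^ 2⌉₊, by positivity, ?_⟩
  intro D _ hD n m s hn₀ hns hσ2
  have hn0 : 0 < n := lt_of_lt_of_le (by positivity) hns
  have hn' : (0 : ℝ) < n := by exact_mod_cast hn0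
  have hns' : (2 : ℝ) * 2 ^ s ≤ n := by exact_mod_cast hns
  have hn₁ : 400 / p + 72 * C ^ 2 / c₁ ^ 2 ≤ n :=
    (Nat.le_ceil _).trans (by exact_mod_cast hn₀)
  have hp400 : 0 < 400 / p := by positivity
  have h72 : 0 ≤ 72 * C ^ 2 / c₁ ^ 2 := by positivity
  have hσ : 0 < sd D := by linarith
  set R : ℝ := (2 : ℝ) ^ (-(s : ℝ) / 2) * sd D with hR
  have hRpos : 0 < R := by positivity
  have hRsq : R ^ 2 = ((2 : ℝ) ^ s)⁻¹ * sd D ^ 2 := by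
    rw [hR, mul_pow, ← Real.rpow_natCast _ 2, ← Real.rpow_mul zero_le_two, ← Real.rpow_natCast _ s,
      ← Real.rpow_neg zero_le_two]
    congr 2
    push_cast
    ring
  set r := c₁ * R with hr
  have hrpos : 0 < r := by positivity
  have hr2 : r ^ 2 = p / 128 * (((2 : ℝ) ^ s)⁻¹ * sd D ^ 2) := by rw [hr, mul_pow, hc₁sq, hRsq]
  -- The argument gives a bound without the logarithm; dividing by `√(log σ)` loses nothing beyond a
  -- factor `2` in the constant.
  have hlog : 1 / 2 ≤ √(Real.log (sd D)) := by
    apply Real.le_sqrt_of_sq_le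
    have h1 : Real.log 2 ≤ Real.log (sd D) := Real.log_le_log two_pos hσ2
    linarith [Real.log_two_gt_d9]
  have htarget : c₁ / 12 * (R / √(Real.log (sd D))) ≤ r / 6 := by
    have : R / √(Real.log (sd D)) ≤ 2 * R := by
      rw [div_le_iff₀ (by linarith)]
      nlinarith
    calc c₁ / 12 * (R / √(Real.log (sd D))) ≤ c₁ / 12 * (2 * R) := by gcongr
      _ = r / 6 := by rw [hr]; ring
  have hfinal : ∀ T : ℝ, r / 6 ≤ T →
      (loadLaw D m s).real {x | (disc x : ℝ) < T} ≤ 15 / 16 → (1 / 16 : ℝ) ≤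
        (loadLaw D m s).real {x | c₁ / 12 * (R / √(Real.log (sd D))) ≤ (disc x : ℝ)} := by
    intro T hT hle
    have h1 := probReal_compl_eq_one_sub (μ := loadLaw D m s) (s := {x | (disc x : ℝ) < T})
      MeasurableSet.of_discrete
    have h2 : (loadLaw D m s).real {x | (disc x : ℝ) < T}ᶜ
        ≤ (loadLaw D m s).real {x | c₁ / 12 * (R / √(Real.log (sd D))) ≤ (disc x : ℝ)} := by
      refine measureReal_mono fun x hx => ?_
      have hx' : T ≤ (disc x : ℝ) := not_lt.1 hx
      exact htarget.trans (hT.trans hx')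
    linarith
  -- For `r ≥ 6` rounding hides the deviation with probability at most `1 / 32`, and `9 / 10 + 1 /
  -- 32 ≤ 15 / 16`. For `r < 6` the target is at most `r / 6 < 1`, so unequal loads suffice.
  rcases le_or_gt 6 r with h6 | h6
  · refine hfinal (r / 2) (by linarith) ?_
    have h1 := real_le_of_card_le D hp (hspread D hD) (by linarith) (flatLoads m s r)
      fun z hz => card_flatLoads_le D m s hns C p r hσ hrpos hr2 z hz
    have h2 := loadLaw_real_le D m s {x | (disc x : ℝ) < r / 2} (flatLoads m s r) _
      (Real.exp_pos (-(r ^ 2 / 4))).le fun x₀ hx₀ => run_disc_lt_le hn0 m s r hrpos.le x₀ hx₀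
    have h3 : Real.exp (-(r ^ 2 / 4)) ≤ 1 / 32 := by
      have h4 : Real.exp (-(r ^ 2 / 4)) ≤ Real.exp (-((5 : ℕ) * 1)) := by
        apply Real.exp_le_exp.2
        push_cast
        nlinarith
      refine h4.trans ?_
      rw [Real.exp_neg, Real.exp_nat_mul, ← one_div]
      refine one_div_le_one_div_of_le (by norm_num) ?_
      have h5 : (2 : ℝ) ≤ Real.exp 1 := by linarith [Real.add_one_le_exp 1]
      calc (32 : ℝ) = 2 ^ 5 := by norm_num
        _ ≤ _ := by gcongr
    linarith
  · refine hfinal 1 (by linarith) ?_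
    -- Bounded `r` together with `2 * 2 ^ s ≤ n` forces `sd D` to be of order `√n` at most; the term
    -- `72 * C ^ 2 / c₁ ^ 2` in the threshold for `n` then yields the claim.
    have hsmall : 2 * (C * sd D) < n := by
      have h1 : sd D ^ 2 = R ^ 2 * 2 ^ s := by
        rw [hRsq]; field_simp
      have h2 : sd D ^ 2 * c₁ ^ 2 < 18 * n := by
        have h3 : r ^ 2 < 36 := by nlinarith
        calc sd D ^ 2 * c₁ ^ 2 = r ^ 2 * 2 ^ s := by rw [h1, hr]; ring
          _ < 36 * 2 ^ s := by gcongr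
          _ ≤ 18 * n := by linarith
      have h4 : 72 * C ^ 2 ≤ n * c₁ ^ 2 := by
        rw [← div_le_iff₀ (by positivity)]
        linarith
      have h5 : (2 * (C * sd D)) ^ 2 * c₁ ^ 2 < (n : ℝ) ^ 2 * c₁ ^ 2 := by
        calc (2 * (C * sd D)) ^ 2 * c₁ ^ 2 = 4 * C ^ 2 * (sd D ^ 2 * c₁ ^ 2) := by ring
          _ < 4 * C ^ 2 * (18 * n) := by gcongr
          _ = 72 * C ^ 2 * n := by ring
          _ ≤ n * c₁ ^ 2 * n := by gcongr
          _ = _ := by ring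
      exact lt_of_pow_lt_pow_left₀ 2 hn'.le (lt_of_mul_lt_mul_right h5 (by positivity))
    have h1 := real_le_of_card_le D hp (hspread D hD) (by linarith) (divisibleLoads n)
      fun z hz => card_divisibleLoads_le D C hσ hsmall z (lt_of_lt_of_le (by positivity) hz)
    have h2 := loadLaw_real_le D m s {x | (disc x : ℝ) < 1} (divisibleLoads n) 0 le_rfl
      fun x₀ hx₀ => (run_disc_lt_one_eq_zero hn0 m s x₀ hx₀).le.trans zero_le
    linarith

end LoadBalancing

theorem mainTheorem6 (A κ : ℝ) (hκ : 0 < κ) :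
    ∃ (K c : ℝ) (n₀ : ℕ), 0 < K ∧ 0 < c ∧
      ∀ (D : MeasureTheory.Measure ℕ) [MeasureTheory.IsProbabilityMeasure D],
        LoadBalancing.ExpConcentrated D A κ →
        -- upper bound for an arbitrary circuit of `d` matchings after `t` rounds
        (∀ (n d t : ℕ) (hd : 0 < d) (m : Fin d → LoadBalancing.Matching n), 0 < n →
          1 - K / (n : ℝ) ≤
            (LoadBalancing.loadLaw D (LoadBalancing.circuit hd m) (d * t)).real
              {x | (LoadBalancing.disc x : ℝ) ≤
                K * (LoadBalancing.lam (LoadBalancing.roundMatrix m) ^ ((t : ℝ) / 4)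
                    * LoadBalancing.sd D * Real.log n ^ (3 / 2 : ℝ) + √(Real.log n))}) ∧
        -- lower bound for an arbitrary circuit of `d` matchings after `t` rounds
        (∀ (n d t : ℕ) (hd : 0 < d) (m : Fin d → LoadBalancing.Matching n), n₀ ≤ n →
          2 * 2 ^ (d * t) ≤ n → 2 ≤ LoadBalancing.sd D →
          (1 / 16 : ℝ) ≤
            (LoadBalancing.loadLaw D (LoadBalancing.circuit hd m) (d * t)).real
              {x | c * ((2 : ℝ) ^ (-((d : ℝ) * t) / 2) * LoadBalancing.sd D
                    / √(Real.log (LoadBalancing.sd D))) ≤ (LoadBalancing.disc x : ℝ)}) ∧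
        -- upper bound for the hypercube after `t` matchings
        (∀ (k t : ℕ) (hk : 0 < k), 1 ≤ t → t < k →
          1 - K / (2 ^ k : ℝ) ≤
            (LoadBalancing.loadLaw D
                (LoadBalancing.circuit hk (LoadBalancing.hypercube k)) t).real
              {x | (LoadBalancing.disc x : ℝ) ≤
                K * ((2 : ℝ) ^ (-(t : ℝ) / 2)
                    * LoadBalancing.sd D * Real.log (2 ^ k) ^ (3 / 2 : ℝ)
                    + √(Real.log (2 ^ k)))}) ∧
        -- lower bound for the hypercube after `t` matchings
        (∀ (k t : ℕ) (hk : 0 < k), n₀ ≤ 2 ^ k → 1 ≤ t → t < k → 2 ≤ LoadBalancing.sd D →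
          (1 / 16 : ℝ) ≤
            (LoadBalancing.loadLaw D
                (LoadBalancing.circuit hk (LoadBalancing.hypercube k)) t).real
              {x | c * ((2 : ℝ) ^ (-(t : ℝ) / 2) * LoadBalancing.sd D
                    / √(Real.log (LoadBalancing.sd D))) ≤ (LoadBalancing.disc x : ℝ)}) := by
  obtain ⟨K, hK, hupper⟩ := LoadBalancing.exists_disc_upper A κ hκ
  obtain ⟨c, n₀, hc, hlower⟩ := LoadBalancing.exists_disc_lower A κ hκ
  refine ⟨K, c, n₀, hK, hc, fun D _ hD => ⟨?_, ?_, ?_, ?_⟩⟩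
  · intro n d t hd m hn
    by_cases hn2 : 2 ≤ n
    · exact hupper D hD n _ _ _ hn
        (Real.rpow_nonneg (LoadBalancing.roundMatrix_lam_bounds hd m hn2).1 _)
        (LoadBalancing.sum_sq_pull_single_sub_circuit_le hd m t)
    · obtain rfl : n = 1 := by omega
      refine hupper D hD 1 _ _ _ hn (Real.rpow_nonneg ?_ _)
        (LoadBalancing.sum_sq_pull_single_sub_circuit_le hd m t)
      -- For `n = 1` there is no second eigenvalue, and `lam` takes the default value `0`.
      simp [LoadBalancing.lam, LoadBalancing.secondAbsEigenvalue]
  · intro n d t hd m hn hdt hσ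
    have h := hlower D hD n (LoadBalancing.circuit hd m) (d * t) hn hdt hσ
    push_cast at h
    exact h
  · intro k t hk _ htk
    have h := hupper D hD (2 ^ k) (LoadBalancing.circuit hk (LoadBalancing.hypercube k)) t
      ((2 : ℝ) ^ (-(t : ℝ) / 2)) (by positivity) (by positivity)
      (LoadBalancing.sum_sq_pull_single_sub_hypercube_le hk t htk.le)
    push_cast at h
    exact h
  · intro k t hk hn _ htk hσ
    refine hlower D hD (2 ^ k) _ t hn ?_ hσ
    -- Here `t < k` is exactly the room required: `2 * 2 ^ t = 2 ^ (t + 1) ≤ 2 ^ k`.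
    rw [← pow_succ']
    exact Nat.pow_le_pow_right two_pos htk
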